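/- Let $n$ and $k$ be positive integers, let $A$ be a set with $k$ elements, and let $B$ be a set. A function $f\colon A^n\to B$ is a \emph{minor} of $g\colon A^m\to B$ if there is a map $\sigma\colon\{1,\dots,m\}\to\{1,\dots,n\}$ such that $f(a_1,\dots,a_n)=g(a_{\sigma(1)},\dots,a_{\sigma(m)})$ for all $(a_1,\dots,a_n)\in A^n$; the functions $f$ and $g$ are \emph{equivalent}, written $f\equiv g$, if each is a minor of the other. For $n\ge 2$, $f\colon A^n\to B$ and $I=\{i,j\}$ with $1\le i<j\le n$, the \emph{identification minor} $f_I\colon A^{n-1}\to B$ is given by $$f_I(a_1,\dots,a_{n-1})=f(a_1,\dots,a_{j-1},a_i,a_j,\dots,a_{n-1}),$$ and the \emph{deck} of $f$ is the multiset of the $\equiv$-classes of the functions $f_I$, where $I$ ranges over the two-element subsets of $\{1,\dots,n\}$. Let $A^\sharp$ be the set of all nonempty finite tuples of pairwise distinct elements of $A$, and for a tuple $\mathbf a\in A^n$ let $\mathrm{ofo}(\mathbf a)\in A^\sharp$ be the tuple obtained from $\mathbf a$ by keeping only the first occurrence of each element. A function $f\colon A^n\to B$ is \emph{weakly determined by the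 order of first occurrence} if there are a map $f^*\colon A^\sharp\to B$ and a permutation $\sigma$ of $\{1,\dots,n\}$ such that $f(a_1,\dots,a_n)=f^*(\mathrm{ofo}(a_{\sigma(1)},\dots,a_{\sigma(n)}))$ for all $(a_1,\dots,a_n)\in A^n$. Assume that $k\equiv 1,2\pmod 4$ and $n\ge k+2$, or that $k\equiv 0,3\pmod 4$ and $n\ge k+3$. Let $f,g\colon A^n\to B$ be functions that are weakly determined by the order of first occurrence. If $f$ and $g$ have the same deck, then $f\equiv g$. In other words, for every finite set $A$ with $k\ge 1$ elements and every set $B$, the class of all functions $A^n\to B$ that are weakly determined by the order of first occurrence and whose arity $n$ satisfies the above condition is weakly reconstructible: any two of its members that have the same arity and the same deck are equivalent. -/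

import Mathlib

namespace MinorReconstruction

universe u v

/-- `f ≤ g`: the function `f : Aⁿ → B` is a minor of `g : Aᵐ → B`. Tuples in `Aⁿ` are maps
`Fin n → A`, and `a σ` is the composite `a ∘ σ`. -/
def IsMinor {A : Type u} {B : Type v} {n m : ℕ}
    (f : (Fin n → A) → B) (g : (Fin m → A) → B) : Prop :=
  ∃ σ : Fin m → Fin n, ∀ a : Fin n → A, f a = g (a ∘ σ)

/-- `f ≡ g`: each of `f` and `g` is a minor of the other. -/
def Equivalent {A : Type u} {B : Type v} {n m : ℕ}
    (f : (Fin n → A) → B) (g : (Fin m → A) → B) : Prop :=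
  IsMinor f g ∧ IsMinor g f

theorem IsMinor.refl {A : Type u} {B : Type v} {n : ℕ} (f : (Fin n → A) → B) :
    IsMinor f f :=
  ⟨id, fun _ => rfl⟩

theorem IsMinor.trans {A : Type u} {B : Type v} {n m l : ℕ} {f : (Fin n → A) → B}
    {g : (Fin m → A) → B} {h : (Fin l → A) → B} (hfg : IsMinor f g) (hgh : IsMinor g h) :
    IsMinor f h := by
  obtain ⟨σ, hσ⟩ := hfg
  obtain ⟨τ, hτ⟩ := hgh
  exact ⟨σ ∘ τ, fun a => by rw [hσ, hτ]; rfl⟩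

/-- The set of all functions of several arguments from `A` to `B`, of any positive arity. -/
structure MultiFun (A : Type u) (B : Type v) where
  arity : ℕ
  arity_pos : 0 < arity
  toFun : (Fin arity → A) → B

/-- The equivalence relation `≡` on all functions of several arguments from `A` to `B`. -/
instance MultiFun.setoid (A : Type u) (B : Type v) : Setoid (MultiFun A B) where
  r f g := Equivalent f.toFun g.toFun
  iseqv :=
    { refl := fun _ => ⟨IsMinor.refl _, IsMinor.refl _⟩
      symm := fun h => ⟨h.2, h.1⟩
      trans := fun h₁ h₂ => ⟨h₁.1.trans h₂.1, h₂.2.trans h₁.2⟩ }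

/-- The two-element subsets `{i, j}` of the index set, each written as the pair `(i, j)`
with `i < j`. -/
abbrev Couple (n : ℕ) : Type := {p : Fin n × Fin n // p.1 < p.2}

theorem Couple.pred_pos {n : ℕ} (I : Couple n) : 0 < n - 1 := by
  obtain ⟨⟨i, j⟩, h⟩ := I
  simp only [Fin.lt_def] at h
  omega

/-- The map `δ_I` for `I = {i, j}`, `i < j`: it fixes every `l < j`, sends `j` to `i`, and sends
every `l > j` to `l - 1`. -/
def delta {n : ℕ} (I : Couple n) (l : Fin n) : Fin (n - 1) :=
  if h₁ : l < I.1.2 then ⟨l.1, by have := I.1.2.2; simp only [Fin.lt_def] at h₁; omega⟩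
  else if l = I.1.2 then
    ⟨I.1.1.1, by have h := I.2; have := I.1.2.2; simp only [Fin.lt_def] at h; omega⟩
  else ⟨l.1 - 1, by have := I.pred_pos; omega⟩

/-- The identification minor `f_I`. -/
def idMinor {A : Type u} {B : Type v} {n : ℕ} (f : (Fin n → A) → B) (I : Couple n) :
    (Fin (n - 1) → A) → B :=
  fun a => f (a ∘ delta I)

/-- The deck of `f`: the multiset of the equivalence classes of the identification minors `f_I`,
with `I` ranging over all couples. -/
def deck {A : Type u} {B : Type v} {n : ℕ} (f : (Fin n → A) → B) :
    Multiset (Quotient (MultiFun.setoid A B)) :=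
  (Finset.univ : Finset (Couple n)).val.map fun I =>
    Quotient.mk (MultiFun.setoid A B) ⟨n - 1, I.pred_pos, idMinor f I⟩

/-- The set of all nonempty tuples of pairwise distinct elements of `A`. -/
abbrev Sharp (A : Type u) : Type u := {l : List A // l ≠ [] ∧ l.Nodup}

/-- Remove all repetitions from a list, retaining the first occurrence of each element. -/
def firstOcc {A : Type u} [DecidableEq A] : List A → List A
  | [] => []
  | x :: xs => x :: (firstOcc xs).filter fun y => y ≠ x

theorem firstOcc_ne_nil {A : Type u} [DecidableEq A] {l : List A} (h : l ≠ []) :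
    firstOcc l ≠ [] := by
  cases l with
  | nil => exact absurd rfl h
  | cons x xs => simp [firstOcc]

theorem firstOcc_nodup {A : Type u} [DecidableEq A] (l : List A) : (firstOcc l).Nodup := by
  induction l with
  | nil => simp [firstOcc]
  | cons x xs ih => simpa [firstOcc] using ih.filter _

/-- The tuple listing the elements that occur in `a` in the order of their first occurrence. -/
def ofo {A : Type u} [DecidableEq A] {n : ℕ} (hn : 0 < n) (a : Fin n → A) : Sharp A :=
  ⟨firstOcc (List.ofFn a),
    firstOcc_ne_nil (by rw [ne_eq, List.ofFn_eq_nil_iff]; omega), firstOcc_nodup _⟩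

/-- `f` is weakly determined by the order of first occurrence. -/
def WeaklyDeterminedByOfo {A : Type u} {B : Type v} [DecidableEq A] {n : ℕ} (hn : 0 < n)
    (f : (Fin n → A) → B) : Prop :=
  ∃ (fstar : Sharp A → B) (σ : Equiv.Perm (Fin n)),
    ∀ a : Fin n → A, f a = fstar (ofo hn (a ∘ σ))

/-- A class `C` of functions is weakly reconstructible if any two members of `C` of the same
arity `n ≥ 2` that have the same deck are equivalent. -/
def WeaklyReconstructible {A : Type u} {B : Type v} (C : Set (MultiFun A B)) : Prop :=
  ∀ (n : ℕ) (hn : 2 ≤ n) (f g : (Fin n → A) → B),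
    (⟨n, by omega, f⟩ : MultiFun A B) ∈ C → (⟨n, by omega, g⟩ : MultiFun A B) ∈ C →
      deck f = deck g → Equivalent f g

/-- The bound on the arity `n` in terms of the cardinality `k` of the domain. -/
def LargeArity (k n : ℕ) : Prop :=
  ((k ≡ 1 [MOD 4] ∨ k ≡ 2 [MOD 4]) ∧ k + 2 ≤ n) ∨
    ((k ≡ 0 [MOD 4] ∨ k ≡ 3 [MOD 4]) ∧ k + 3 ≤ n)

end MinorReconstruction

open MinorReconstruction

/-! Up to a permutation of the arguments, `f` and `g` are given by maps `F` and `G` on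
repetition-free words, so it is enough to show `F = G`; a single common card suffices. A card is
described by a word `U` of `m = n - 1` distinct labels: substitute letters for the labels, keep
first occurrences, apply `F`. Equivalence of two cards provides a map between their labels. If it is
not bijective, both cards have an inessential argument, and then `F` and `G` see only the first
letter. Otherwise the second word becomes a permutation `V` of `U`, and `F` on the word spelled by
`U` equals `G` on the word spelled by `V`, for every substitution.

The equality of `F` and `G` is proved separately for each number `r ≤ k` of distinct letters. The
critical level is `r = m - 1`, where exactly two labels receive the same letter. Two substitutions
that spell the same word on one side give a symmetry of the function on the other side.
`LevelRel.exists_split` turns this into a cut: the two words have the same labels before it, and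
both functions ignore the order of the letters after it. Freezing final letters and inducting on the
number of labels, `solvable` gives agreement unless `V` is `U` with consecutive pairs swapped,
counted from the end. In that exceptional case the symmetries used are rotations of three letters,
which are even; they suffice when the number of pairs is odd, that is `m ≡ 2, 3 (mod 4)`
(`PairSwap.agree`).

For `r ≤ m - 2` labels can first be identified so as to leave the exceptional case
(`exists_merge_not_pairSwap`). The arity bound ensures that `r = m - 1` arises only for `r = k` with
`k ≡ 1, 2 (mod 4)`, where both cases are covered. -/

namespace MinorReconstruction

universe u v w

set_option linter.unusedSectionVars false

/-! ### Words of first occurrences -/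

section FirstOcc

variable {A : Type u} [DecidableEq A] {ι : Type w}

theorem mem_firstOcc {l : List A} {x : A} : x ∈ firstOcc l ↔ x ∈ l := by
  induction l with
  | nil => simp [firstOcc]
  | cons y l ih =>
    simp only [firstOcc, List.mem_cons, List.mem_filter, ih, decide_eq_true_eq]
    by_cases h : x = y <;> simp [h]

theorem firstOcc_append (l₁ l₂ : List A) :
    firstOcc (l₁ ++ l₂) = firstOcc l₁ ++ (firstOcc l₂).filter fun y => y ∉ l₁ := by
  induction l₁ with
  | nil => simp [firstOcc]
  | cons x l ih =>
    simp only [List.cons_append, firstOcc, ih, List.filter_append, List.filter_filter,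
      List.mem_cons, not_or]
    congr 2
    apply List.filter_congr
    intro y _
    simp

theorem firstOcc_of_nodup {l : List A} (h : l.Nodup) : firstOcc l = l := by
  induction l with
  | nil => rfl
  | cons x l ih =>
    rw [List.nodup_cons] at h
    rw [firstOcc, ih h.2, List.filter_eq_self.2]
    intro y hy
    simp only [decide_eq_true_eq]
    rintro rfl
    exact h.1 hy

theorem firstOcc_append_of_nodup {l₁ l₂ : List A} (h : l₂.Nodup) (hd : ∀ x ∈ l₂, x ∉ l₁) :
    firstOcc (l₁ ++ l₂) = firstOcc l₁ ++ l₂ := by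
  rw [firstOcc_append, firstOcc_of_nodup h, List.filter_eq_self.2]
  simpa using hd

theorem firstOcc_append_of_subset {l₁ l₂ : List A} (h : ∀ x ∈ l₂, x ∈ l₁) :
    firstOcc (l₁ ++ l₂) = firstOcc l₁ := by
  rw [firstOcc_append, List.filter_eq_nil_iff.2, List.append_nil]
  intro x hx
  simpa using h x (mem_firstOcc.1 hx)

theorem firstOcc_append_cons_of_mem {l₁ l₂ : List A} {x : A} (h : x ∈ l₁) :
    firstOcc (l₁ ++ x :: l₂) = firstOcc (l₁ ++ l₂) := by
  have e : l₁ ++ x :: l₂ = (l₁ ++ [x]) ++ l₂ := by simp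
  rw [e, firstOcc_append, firstOcc_append l₁ l₂, firstOcc_append_of_subset (by simpa using h)]
  congr 1
  apply List.filter_congr
  intro y _
  simp only [List.mem_append, List.mem_singleton]
  by_cases hy : y = x
  · subst hy; simp [h]
  · simp [hy]

theorem firstOcc_perm {l₁ l₂ : List A} (h : l₁.Perm l₂) :
    (firstOcc l₁).Perm (firstOcc l₂) := by
  rw [List.perm_ext_iff_of_nodup (firstOcc_nodup _) (firstOcc_nodup _)]
  intro x
  rw [mem_firstOcc, mem_firstOcc, h.mem_iff]

theorem length_firstOcc_le (l : List A) : (firstOcc l).length ≤ l.length := by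
  induction l with
  | nil => simp [firstOcc]
  | cons x l ih =>
    simp only [firstOcc, List.length_cons]
    have := List.length_filter_le (fun y => decide (y ≠ x)) (firstOcc l)
    omega

theorem firstOcc_append_cons_eq {l₁ l₂ : List A} {x : A} (h : (l₁ ++ l₂).Nodup) (hx : x ∈ l₂) :
    firstOcc (l₁ ++ x :: l₂) = l₁ ++ x :: l₂.erase x := by
  rw [List.nodup_append] at h
  rw [firstOcc_append, firstOcc_of_nodup h.1, firstOcc, firstOcc_of_nodup h.2.1,
    h.2.1.erase_eq_filter, List.filter_eq_self.2]
  · congr 2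
    apply List.filter_congr
    intro y _
    by_cases hy : y = x <;> simp [hy]
  · intro y hy
    have : y ∈ l₂ := by
      rcases List.mem_cons.1 hy with rfl | hy
      · exact hx
      · exact (List.mem_filter.1 hy).1
    simp only [decide_eq_true_eq]
    intro hy1
    exact h.2.2 y hy1 y this rfl

theorem firstOcc_filter_map [DecidableEq ι] (a : ι → A) (x : ι) (l : List ι) :
    (firstOcc ((l.filter fun y => y ≠ x).map a)).filter (fun z => z ≠ a x) =
      (firstOcc (l.map a)).filter (fun z => z ≠ a x) := by
  induction l with
  | nil => simp
  | cons y l ih =>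
    by_cases hy : y = x
    · subst hy
      rw [List.filter_cons_of_neg (by simp), List.map_cons, firstOcc,
        List.filter_cons_of_neg (by simp), ih, List.filter_filter]
      simp only [Bool.and_self]
    · rw [List.filter_cons_of_pos (by simpa using hy)]
      simp only [List.map_cons, firstOcc]
      by_cases h : a y = a x
      · rw [List.filter_cons_of_neg (by simp [h]), List.filter_cons_of_neg (by simp [h])]
        rw [h, List.filter_filter, List.filter_filter]
        simpa only [Bool.and_self] using ih
      · rw [List.filter_cons_of_pos (by simp [h]), List.filter_cons_of_pos (by simp [h])]
        rw [List.filter_comm, ih, List.filter_comm]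

/-- A repeated label spells a letter that has already been seen. Hence cards and identifications of
labels can always be described by repetition-free words of labels. -/
theorem firstOcc_map_firstOcc [DecidableEq ι] (a : ι → A) (l : List ι) :
    firstOcc ((firstOcc l).map a) = firstOcc (l.map a) := by
  induction l with
  | nil => rfl
  | cons x l ih =>
    simp only [firstOcc, List.map_cons]
    rw [firstOcc_filter_map, ih]

end FirstOcc

section Assignments

variable {A : Type u} {ι : Type w}

theorem exists_map_eq [DecidableEq ι] (a₀ : ι → A) {U : List ι} (hU : U.Nodup) {l : List A}
    (h : U.length = l.length) : ∃ a : ι → A, U.map a = l := by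
  induction U generalizing l with
  | nil => exact ⟨a₀, by simpa using (List.length_eq_zero_iff.1 h.symm).symm⟩
  | cons x U ih =>
    cases l with
    | nil => simp at h
    | cons y l =>
      rw [List.nodup_cons] at hU
      obtain ⟨a, ha⟩ := ih hU.2 (by simpa using h)
      refine ⟨Function.update a x y, ?_⟩
      rw [List.map_cons, Function.update_self, ← ha]
      congr 1
      apply List.map_congr_left
      intro z hz
      rw [Function.update_of_ne]
      rintro rfl
      exact hU.1 hz

theorem map_eq_map_of_perm {U V : List ι} (h : U.Perm V) {a b : ι → A}
    (hab : V.map a = V.map b) : U.map a = U.map b := by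
  rw [List.map_inj_left] at hab ⊢
  exact fun x hx => hab x (h.mem_iff.1 hx)

end Assignments

/-! ### Symmetries of the tail at a fixed level -/

section Level

variable {A : Type u} {C : Type v} {ι : Type w} [DecidableEq A] [DecidableEq ι]

/-- The functions `f` and `g` of the order of first occurrence take the same values on the words
spelled by `U` and `V`, whenever exactly `r` letters occur. -/
def LevelRel (r : ℕ) (f g : List A → C) (U V : List ι) : Prop :=
  ∀ a : ι → A, (firstOcc (U.map a)).length = r → f (firstOcc (U.map a)) = g (firstOcc (V.map a))

/-- `f` and `g` agree on repetition-free words of length `r`. -/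
def Agree (r : ℕ) (f g : List A → C) : Prop :=
  ∀ l : List A, l.Nodup → l.length = r → f l = g l

/-- On repetition-free words of length `r`, the value of `g` does not depend on the order of the
letters after the first `t`. -/
def TailInv (r t : ℕ) (g : List A → C) : Prop :=
  ∀ v l l' : List A, v.length = t → (v ++ l).length = r → (v ++ l).Nodup → l.Perm l' →
    g (v ++ l) = g (v ++ l')

variable {r t : ℕ} {f g : List A → C} {U V : List ι}

theorem LevelRel.symm (h : LevelRel r f g U V) (hp : U.Perm V) : LevelRel r g f V U := by
  intro a ha
  refine (h a ?_).symm
  rw [(firstOcc_perm (hp.map a)).length_eq, ha]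

theorem LevelRel.minor {κ : Type*} [DecidableEq κ] (h : LevelRel r f g U V) (φ : ι → κ) :
    LevelRel r f g (firstOcc (U.map φ)) (firstOcc (V.map φ)) := by
  intro a
  rw [firstOcc_map_firstOcc, firstOcc_map_firstOcc, List.map_map, List.map_map]
  exact h (a ∘ φ)

theorem TailInv.mono {t' : ℕ} (h : TailInv r t g) (ht : t ≤ t') : TailInv r t' g := by
  intro v l l' hv hl hn hp
  have e : ∀ l, v ++ l = v.take t ++ (v.drop t ++ l) := by
    intro l; rw [← List.append_assoc, List.take_append_drop]
  rw [e l, e l']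
  refine h _ _ _ (by simp; omega) (by rw [← e, hl]) (by rwa [← e]) (hp.append_left _)

theorem tailInv_pred (hr : 1 ≤ r) (g : List A → C) : TailInv r (r - 1) g := by
  intro v l l' hv hl _ hp
  rw [List.length_append] at hl
  obtain ⟨x, rfl⟩ := List.length_eq_one_iff.1 (show l.length = 1 by omega)
  rw [List.singleton_perm.1 hp]

theorem tailInv_of_swap
    (h : ∀ (v l : List A) (x y : A), t ≤ v.length → (v ++ x :: y :: l).length = r →
      (v ++ x :: y :: l).Nodup → g (v ++ x :: y :: l) = g (v ++ y :: x :: l)) :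
    TailInv r t g := by
  intro v l l' hv hl hn hp
  replace hv : t ≤ v.length := hv.ge
  induction hp generalizing v with
  | nil => rfl
  | cons x hp ih =>
    have := ih (v ++ [x]) (by simpa using hl) (by simpa using hn) (by simp; omega)
    simpa using this
  | swap x y l => exact h v l y x hv hl hn
  | trans h₁ h₂ ih₁ ih₂ =>
    rw [ih₁ v hl hn hv]
    refine ih₂ v ?_ ?_ hv
    · rw [← (h₁.append_left v).length_eq, hl]
    · rwa [← (h₁.append_left v).nodup_iff]

/-- The target order is built letter by letter. The hypothesis passes to words behind a fixed first
letter `i`: move `j` to the front, then `i` in front of it. -/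
theorem eq_of_perm_of_move_front {h : List A → C} {l l' : List A} (hn : l.Nodup)
    (H : ∀ z : List A, z.Perm l → ∀ i ∈ z, h z = h (i :: z.erase i)) (hp : l.Perm l') :
    h l = h l' := by
  induction l' generalizing l h with
  | nil => rw [hp.eq_nil]
  | cons i l' ih =>
    have hi : i ∈ l := hp.mem_iff.2 (by simp)
    rw [H l (List.Perm.refl _) i hi]
    have hl : (i :: l.erase i).Perm l := (List.perm_cons_erase hi).symm
    refine ih (h := fun z => h (i :: z)) (List.nodup_cons.1 (hl.nodup_iff.2 hn)).2 ?_ ?_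
    · intro z hz j hj
      have hz' : (i :: z).Perm l := (hz.cons i).trans hl
      have hij : j ≠ i := by
        rintro rfl
        exact (List.nodup_cons.1 (hz'.nodup_iff.2 hn)).1 hj
      have h₁ := H (i :: z) hz' j (by simp [hj])
      rw [List.erase_cons_tail (by simpa using Ne.symm hij)] at h₁
      have h₂ := H (j :: i :: z.erase j)
        (((List.Perm.swap i j _).trans ((List.perm_cons_erase hj).symm.cons i)).trans hz') i
        (by simp)
      rw [List.erase_cons_tail (by simpa using hij), List.erase_cons_head] at h₂
      rw [h₁, h₂]
    · exact (List.perm_cons i).1 (hl.trans hp)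

end Level

section Level

variable {A : Type u} {C : Type v} {ι : Type w} [DecidableEq A] [DecidableEq ι]
variable {r t : ℕ} {f g : List A → C} {U V : List ι}

/-- Among `r + 1` labels spelling `r` letters there is only one repetition, so `t + 1` labels spell
at least `t` letters. All later labels therefore contribute only to the part of the word whose order
is irrelevant to `g`. -/
theorem LevelRel.permute_tail {V₁ V₂ V₂' : List ι} (h : LevelRel r f g U (V₁ ++ V₂))
    (hp : U.Perm (V₁ ++ V₂)) (hlen : U.length = r + 1) (ht : TailInv r t g)
    (htV : t + 1 ≤ V₁.length) (hV : V₂.Perm V₂') : LevelRel r f g U (V₁ ++ V₂') := by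
  intro a ha
  rw [h a ha]
  have e₀ := (firstOcc_perm (hp.map a)).length_eq
  rw [ha] at e₀
  have hn := firstOcc_nodup ((V₁ ++ V₂).map a)
  have hl := hp.length_eq
  rw [hlen, List.length_append] at hl
  rw [List.map_append, firstOcc_append] at e₀ hn
  rw [List.map_append, List.map_append, firstOcc_append, firstOcc_append]
  have hlen₂ : ((firstOcc (V₂.map a)).filter fun y => y ∉ V₁.map a).length ≤ V₂.length :=
    (List.length_filter_le _ _).trans ((length_firstOcc_le _).trans (by simp))
  have e₁ := e₀
  rw [List.length_append] at e₁
  exact (ht.mono (by omega)) _ _ _ rfl e₀.symm hn ((firstOcc_perm (hV.map a)).filter _)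

/-- Let the other labels spell distinct letters and give `M` one of these. On the left `M` comes
last and has no effect; on the right it moves the chosen letter to just after the first `V₁.length`
letters. So every such move leaves `g` unchanged. -/
theorem LevelRel.tailInv {U₁ V₁ V₂ : List ι} {M : ι}
    (h : LevelRel r f g (U₁ ++ [M]) (V₁ ++ M :: V₂)) (hn : (U₁ ++ [M]).Nodup)
    (hp : (U₁ ++ [M]).Perm (V₁ ++ M :: V₂)) (hlen : U₁.length = r) (hr : 1 ≤ r) :
    TailInv r V₁.length g := by
  intro v l l' hv hl hvl hll
  have hpU : U₁.Perm (V₁ ++ V₂) := by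
    have := hp.trans List.perm_middle
    exact (List.perm_cons M).1 ((List.perm_append_singleton M U₁).symm.trans this)
  have hMU : M ∉ U₁ := by
    intro hM
    rw [List.nodup_append] at hn
    exact hn.2.2 M hM M (by simp) rfl
  have hMV : M ∉ V₁ ++ V₂ := fun hM => hMU (hpU.mem_iff.2 hM)
  have hnV : (V₁ ++ V₂).Nodup := hpU.nodup_iff.1 (List.nodup_append.1 hn).1
  have hlV := hpU.length_eq
  rw [List.length_append] at hlV hl
  have hlp := hll.length_eq
  obtain ⟨c, hc⟩ : ∃ c, c ∈ v ++ l := by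
    apply List.exists_mem_of_length_pos
    rw [List.length_append]; omega
  -- The letter assigned to `M` may be any letter of the word.
  have key : ∀ z : List A, z.Perm l → ∃ B : C, ∀ i ∈ v ++ z, g (firstOcc (v ++ i :: z)) = B := by
    intro z hz
    have hz' := hz.length_eq
    have hvz : (v ++ z).Nodup := (hz.append_left v).nodup_iff.2 hvl
    obtain ⟨a, ha⟩ := exists_map_eq (fun _ => c) hnV (l := v ++ z) (by simp; omega)
    have hU : (U₁.map a).Perm (v ++ z) := by rw [← ha]; exact hpU.map a
    refine ⟨f (U₁.map a), fun i hi => ?_⟩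
    have hup : ∀ W : List ι, M ∉ W → W.map (Function.update a M i) = W.map a := by
      intro W hW
      apply List.map_congr_left
      intro x hx
      rw [Function.update_of_ne]
      rintro rfl
      exact hW hx
    have e₁ : firstOcc ((U₁ ++ [M]).map (Function.update a M i)) = U₁.map a := by
      rw [List.map_append, hup _ hMU, firstOcc_append_of_subset,
        firstOcc_of_nodup (hU.nodup_iff.2 hvz)]
      simp only [List.map_cons, Function.update_self, List.map_nil, List.mem_singleton,
        forall_eq]
      exact hU.mem_iff.2 hi
    have e₂ : (V₁ ++ M :: V₂).map (Function.update a M i) = v ++ i :: z := by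
      rw [List.map_append] at ha
      obtain ⟨h₁, h₂⟩ := List.append_inj ha (by simp [hv])
      rw [List.map_append, List.map_cons, hup V₁ (fun h => hMV (by simp [h])),
        hup V₂ (fun h => hMV (by simp [h])), h₁, h₂, Function.update_self]
    have := h (Function.update a M i) (by rw [e₁]; simpa using hlen)
    rw [e₁, e₂] at this
    exact this.symm
  refine eq_of_perm_of_move_front (h := fun z => g (v ++ z)) (List.nodup_append.1 hvl).2.1 ?_ hll
  intro z hz i hi
  have hvz : (v ++ z).Nodup := (hz.append_left v).nodup_iff.2 hvl
  obtain ⟨B, hB⟩ := key z hz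
  have h₁ := hB i (by simp [hi])
  rw [firstOcc_append_cons_eq hvz hi] at h₁
  show g (v ++ z) = g (v ++ i :: z.erase i)
  rw [h₁]
  -- The unmodified word arises when the letter of `M` has already occurred in `v`, or, for empty
  -- `v`, when it is the first letter of `z`.
  cases v with
  | cons x v =>
    have h₂ := hB x (by simp)
    rwa [firstOcc_append_cons_of_mem (by simp), firstOcc_of_nodup hvz] at h₂
  | nil =>
    cases z with
    | nil => simp at hi
    | cons x z =>
      have h₂ := hB x (by simp)
      rw [List.nil_append] at hvz
      rw [List.nil_append, show x :: x :: z = [x] ++ x :: z by rfl,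
        firstOcc_append_cons_of_mem (by simp)] at h₂
      rwa [List.singleton_append, firstOcc_of_nodup hvz] at h₂

theorem take_perm_take {p : ℕ} (hn : U.Nodup) (hp : U.Perm V)
    (h : ∀ x ∈ U.drop p, x ∉ V.take p) : (U.take p).Perm (V.take p) := by
  have hV : V.Nodup := hp.nodup_iff.1 hn
  have hs : V.take p ⊆ U.take p := by
    intro x hx
    have hxU : x ∈ U := hp.mem_iff.2 (List.mem_of_mem_take hx)
    rw [← List.take_append_drop p U, List.mem_append] at hxU
    exact hxU.resolve_right fun hd => h x hd hx
  have hsub := List.subperm_of_subset (hV.sublist (List.take_sublist p V)) hs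
  refine (hsub.perm_of_length_le ?_).symm
  simp [hp.length_eq]

/-- The tail invariance of `f` allows `x` to be moved to the end of `U`. Then `LevelRel.tailInv`
makes `g` invariant after the position of `x` in `V`, so minimality of `t` keeps `x` out of the
first `t` places. -/
theorem LevelRel.mem_drop {e : ℕ} (h : LevelRel r f g U V) (hn : U.Nodup) (hp : U.Perm V)
    (hlen : U.length = r + 1) (hr : 1 ≤ r) (he : TailInv r e f) {t : ℕ}
    (ht : ∀ s, TailInv r s g → t ≤ s) {x : ι} (hx : x ∈ U.drop (e + 1)) : x ∉ V.take t := by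
  have hxU : x ∈ U := List.mem_of_mem_drop hx
  have hel : e + 1 ≤ U.length := by
    by_contra hlt
    rw [List.drop_eq_nil_of_le (by omega)] at hx
    simp at hx
  have hperm : (U.drop (e + 1)).Perm ((U.drop (e + 1)).erase x ++ [x]) :=
    (List.perm_cons_erase hx).trans (List.perm_append_singleton x _).symm
  have h' := h.symm hp
  rw [← List.take_append_drop (e + 1) U] at h'
  have h₁ := h'.permute_tail (by rw [List.take_append_drop]; exact hp.symm)
    (by rw [← hp.length_eq, hlen]) he (by simp; omega) hperm
  have hU' : (U.take (e + 1) ++ ((U.drop (e + 1)).erase x ++ [x])).Perm U := by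
    conv_rhs => rw [← List.take_append_drop (e + 1) U]
    exact hperm.symm.append_left _
  have h₂ := h₁.symm (hp.symm.trans hU'.symm)
  rw [← List.append_assoc] at h₂ hU'
  obtain ⟨V₁, V₂, rfl⟩ := List.append_of_mem (hp.mem_iff.1 hxU)
  have hle := hU'.length_eq
  rw [List.length_append, List.length_singleton] at hle
  have hT := h₂.tailInv (hU'.nodup_iff.2 hn) (hU'.trans hp) (by omega) hr
  intro hxt
  have hnV := hp.nodup_iff.1 hn
  rw [List.take_append_of_le_length (ht _ hT)] at hxt
  rw [List.nodup_append] at hnV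
  exact hnV.2.2 x (List.mem_of_mem_take hxt) x (by simp) rfl

/-- The cut is placed according to the least tail invariances `e` of `f` and `t` of `g`, using
`LevelRel.mem_drop` in both directions. -/
theorem LevelRel.exists_split (h : LevelRel r f g U V) (hn : U.Nodup) (hp : U.Perm V)
    (hlen : U.length = r + 1) (hr : 1 ≤ r) :
    ∃ p ≤ r, TailInv r p f ∧ TailInv r p g ∧ (U.take p).Perm (V.take p) := by
  classical
  have hf : ∃ e, TailInv r e f := ⟨_, tailInv_pred hr f⟩
  have hg : ∃ e, TailInv r e g := ⟨_, tailInv_pred hr g⟩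
  obtain ⟨e, he, hemin⟩ : ∃ e, TailInv r e f ∧ ∀ s, TailInv r s f → e ≤ s :=
    ⟨Nat.find hf, Nat.find_spec hf, fun s hs => Nat.find_min' hf hs⟩
  obtain ⟨t, ht, htmin⟩ : ∃ e, TailInv r e g ∧ ∀ s, TailInv r s g → e ≤ s :=
    ⟨Nat.find hg, Nat.find_spec hg, fun s hs => Nat.find_min' hg hs⟩
  have her := hemin _ (tailInv_pred hr f)
  have htr := htmin _ (tailInv_pred hr g)
  have hA : ∀ x ∈ U.drop (e + 1), x ∉ V.take t := fun x hx =>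
    h.mem_drop hn hp hlen hr he htmin hx
  have hB : ∀ x ∈ V.drop (t + 1), x ∉ U.take e := fun x hx =>
    (h.symm hp).mem_drop (hp.nodup_iff.1 hn) hp.symm (by rw [← hp.length_eq, hlen]) hr ht
      hemin hx
  rcases lt_trichotomy e t with het | het | het
  · refine ⟨t, by omega, he.mono het.le, ht, take_perm_take hn hp fun x hx => hA x ?_⟩
    exact List.drop_subset_drop_left _ het hx
  · subst het
    have hte : e < V.length := by rw [← hp.length_eq]; omega
    -- When `e = t`, the label at place `e` is not controlled by `hA` and `hB`; its position decides
    -- between the cuts `e + 1` and `e`.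
    by_cases hy : V[e] ∈ U.take e
    · refine ⟨e + 1, by omega, he.mono (by omega), ht.mono (by omega),
        take_perm_take hn hp fun x hx hxV => ?_⟩
      rw [List.take_succ_eq_append_getElem hte, List.mem_append, List.mem_singleton] at hxV
      rcases hxV with hxV | rfl
      · exact hA x hx hxV
      · have := (List.nodup_append.1 ((List.take_append_drop e U).symm ▸ hn)).2.2 _ hy
        exact this _ (List.drop_subset_drop_left _ (by omega) hx) rfl
    · refine ⟨e, by omega, he, ht, (take_perm_take (hp.nodup_iff.1 hn) hp.symm
        fun x hx hxU => ?_).symm⟩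
      rw [List.drop_eq_getElem_cons hte, List.mem_cons] at hx
      rcases hx with rfl | hx
      · exact hy hxU
      · exact hB x hx hxU
  · refine ⟨e, by omega, he, ht.mono het.le, (take_perm_take (hp.nodup_iff.1 hn) hp.symm
      fun x hx => hB x ?_).symm⟩
    exact List.drop_subset_drop_left _ het hx

end Level

/-! ### Freezing the last letters -/

section Freeze

variable {A : Type u} {C : Type v} {ι : Type w} [DecidableEq A] [DecidableEq ι]

/-- Append to the argument of `f` the image under `π` of a word of length `n`, keeping track of
all words for which no letter is repeated. -/
def freeze (π : List A → List A) (n : ℕ) (f : List A → C) (l : List A) : List A → Option C :=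
  fun s => if (l ++ s).Nodup ∧ s.length = n then some (f (l ++ π s)) else none

/-- The labels of `W` are given distinct letters that do not occur elsewhere, so the repetition is
among the labels of `U`. The frozen letters become a parameter `s` of the value, which leaves a
relation with `n` fewer labels and letters. -/
theorem LevelRel.freeze {r n : ℕ} {f g : List A → C} {U V W W' : List ι} {π : List A → List A}
    (h : LevelRel (r + n) f g (U ++ W) (V ++ W')) (hn : (U ++ W).Nodup) (hp : U.Perm V)
    (hW : W.length = n) (hW' : ∀ a : ι → A, W'.map a = π (W.map a))
    (hπ : ∀ s : List A, s.length = n → (π s).Perm s) :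
    LevelRel r (freeze id n f) (freeze π n g) U V := by
  intro a ha
  funext s
  have hpa := firstOcc_perm (hp.map a)
  simp only [MinorReconstruction.freeze, ← (hpa.append_right s).nodup_iff]
  split_ifs with hs
  · obtain ⟨b, hb⟩ := exists_map_eq a hn (l := U.map a ++ s) (by simp [hW, hs.2])
    rw [List.map_append] at hb
    obtain ⟨hbU, hbW⟩ := List.append_inj hb (by simp)
    have hbV : V.map b = V.map a := map_eq_map_of_perm hp.symm hbU
    have hd := List.nodup_append.1 hs.1
    have e₁ : firstOcc ((U ++ W).map b) = firstOcc (U.map a) ++ s := by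
      rw [List.map_append, hbU, hbW, firstOcc_append_of_nodup hd.2.1]
      intro x hx hxU
      exact hd.2.2 x (mem_firstOcc.2 hxU) x hx rfl
    have e₂ : firstOcc ((V ++ W').map b) = firstOcc (V.map a) ++ π s := by
      rw [List.map_append, hbV, hW', hbW,
        firstOcc_append_of_nodup ((hπ s hs.2).nodup_iff.2 hd.2.1)]
      intro x hx hxV
      exact hd.2.2 x (hpa.mem_iff.2 (mem_firstOcc.2 hxV)) x ((hπ s hs.2).mem_iff.1 hx) rfl
    have := h b (by rw [e₁]; simp [ha, hs.2])
    rw [e₁, e₂] at this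
    rw [id, this]
  · rfl

theorem Agree.of_freeze {r n : ℕ} {f g : List A → C} {π : List A → List A}
    (h : Agree r (freeze id n f) (freeze π n g)) {l s : List A} (hn : (l ++ s).Nodup)
    (hl : l.length = r) (hs : s.length = n) : f (l ++ s) = g (l ++ π s) := by
  have := congrFun (h l (List.nodup_append.1 hn).1 hl) s
  simpa [freeze, hn, hs] using this

end Freeze

/-! ### Symmetries from short final patterns -/

section Spelling

variable {A : Type u} {C : Type v} {ι : Type w} [DecidableEq A] [DecidableEq ι]

theorem firstOcc_of_dup {l₁ l₂ : List A} {x : A} (h : x ∈ l₁) (hn : (l₁ ++ l₂).Nodup) :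
    firstOcc (l₁ ++ x :: l₂) = l₁ ++ l₂ := by
  rw [firstOcc_append_cons_of_mem h, firstOcc_of_nodup hn]

/-- The word `u` depends only on `v`, not on the letters given to `W`. Two substitutions that differ
only on `W` can thus be compared. -/
theorem exists_spelling {U V W : List ι} (hn : (U ++ W).Nodup) (hp : U.Perm V) (c : A)
    {v : List A} (hv : v.length = V.length) :
    ∃ u : List A, u.Perm v ∧ ∀ s : List A, s.length = W.length →
      ∃ a : ι → A, U.map a = u ∧ V.map a = v ∧ W.map a = s := by
  have hn' : (V ++ W).Nodup := (hp.append_right W).nodup_iff.1 hn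
  obtain ⟨b, hb⟩ := exists_map_eq (fun _ => c) (List.nodup_append.1 hn').1 hv.symm
  refine ⟨U.map b, hb ▸ hp.map b, fun s hs => ?_⟩
  obtain ⟨a, ha⟩ := exists_map_eq b hn' (l := v ++ s) (by simp [hs, hv])
  rw [List.map_append] at ha
  obtain ⟨h₁, h₂⟩ := List.append_inj ha (by simp [hv])
  exact ⟨a, map_eq_map_of_perm hp (h₁.trans hb.symm), h₁, h₂⟩

theorem LevelRel.apply {r : ℕ} {f g : List A → C} {U V : List ι} (h : LevelRel r f g U V)
    (a : ι → A) {l l' : List A} (hU : firstOcc (U.map a) = l) (hV : firstOcc (V.map a) = l')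
    (hl : l.length = r) : f l = g l' := by
  subst hU hV
  exact h a hl

theorem nodup_append_of_perm {u v s t : List A} (h : (v ++ s).Nodup) (hu : u.Perm v)
    (hs : t.Perm s) : (u ++ t).Nodup :=
  (hu.append hs).nodup_iff.2 h

variable {r : ℕ} {f g : List A → C} {U V : List ι}

theorem LevelRel.eq_of_swap_end {x y : ι} (h : LevelRel r f g (U ++ [x, y]) (V ++ [y, x]))
    (hn : (U ++ [x, y]).Nodup) (hp : U.Perm V) (hr : U.length + 1 = r) (c : A) {v : List A}
    (hv : v.length = V.length) :
    ∃ u : List A, u.Perm v ∧ ∀ b : A, (v ++ [b]).Nodup → f (u ++ [b]) = g (v ++ [b]) := by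
  obtain ⟨u, hu, H⟩ := exists_spelling hn hp c hv
  refine ⟨u, hu, fun b hb => ?_⟩
  obtain ⟨a, hU, hV, hW⟩ := H [b, b] rfl
  simp only [List.map_cons, List.map_nil, List.cons.injEq, and_true] at hW
  have hub := nodup_append_of_perm hb hu (List.Perm.refl _)
  refine h.apply a ?_ ?_ ?_
  · simpa [hU, hW] using firstOcc_of_dup (l₁ := u ++ [b]) (l₂ := []) (x := b) (by simp)
      (by simpa using hub)
  · simpa [hV, hW] using firstOcc_of_dup (l₁ := v ++ [b]) (l₂ := []) (x := b) (by simp)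
      (by simpa using hb)
  · simp [hu.length_eq, hv, ← hp.length_eq, hr]

/-- Giving `t` an earlier letter, or identifying `x` with `y`, spells the same word on the left and
words differing in the last two letters on the right. -/
theorem LevelRel.swap_last_of_fixed_before {t x y : ι}
    (h : LevelRel r f g (U ++ [t, x, y]) (V ++ [t, y, x])) (hn : (U ++ [t, x, y]).Nodup)
    (hp : U.Perm V) (hU : U ≠ []) (hr : U.length + 2 = r) {v : List A} {b c : A}
    (hv : v.length = V.length) (hvn : (v ++ [b, c]).Nodup) : g (v ++ [b, c]) = g (v ++ [c, b]) := by
  obtain ⟨u, hu, H⟩ := exists_spelling hn hp b hv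
  have hUl := List.length_pos_iff.2 hU
  have hlen := hp.length_eq
  obtain ⟨d, hd⟩ : ∃ d, d ∈ v := List.exists_mem_of_length_pos (by omega)
  have hubc := nodup_append_of_perm hvn hu (List.Perm.refl _)
  have hvcb := nodup_append_of_perm hvn (List.Perm.refl _) (List.Perm.swap b c [])
  have hul := hu.length_eq
  obtain ⟨a₁, hU₁, hV₁, hW₁⟩ := H [d, b, c] rfl
  obtain ⟨a₂, hU₂, hV₂, hW₂⟩ := H [b, c, c] rfl
  simp only [List.map_cons, List.map_nil, List.cons.injEq, and_true] at hW₁ hW₂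
  have h₁ : f (u ++ [b, c]) = g (v ++ [c, b]) := by
    refine h.apply a₁ ?_ ?_ ?_
    · simpa [hU₁, hW₁] using firstOcc_of_dup (l₁ := u) (x := d) (hu.mem_iff.2 hd) hubc
    · simpa [hV₁, hW₁] using firstOcc_of_dup (l₁ := v) (x := d) hd hvcb
    · simp; omega
  have h₂ : f (u ++ [b, c]) = g (v ++ [b, c]) := by
    refine h.apply a₂ ?_ ?_ ?_
    · simpa [hU₂, hW₂] using firstOcc_of_dup (l₁ := u ++ [b, c]) (l₂ := []) (x := c) (by simp)
        (by simpa using hubc)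
    · simpa [hV₂, hW₂] using firstOcc_of_dup (l₁ := v ++ [b, c]) (l₂ := []) (x := c) (by simp)
        (by simpa using hvn)
    · simp; omega
  rw [← h₁, h₂]

theorem LevelRel.swap_last_of_fixed_after {x y M : ι}
    (h : LevelRel r f g (U ++ [x, y, M]) (V ++ [y, x, M])) (hn : (U ++ [x, y, M]).Nodup)
    (hp : U.Perm V) (hr : U.length + 2 = r) {v : List A} {b c : A}
    (hv : v.length = V.length) (hvn : (v ++ [b, c]).Nodup) :
    ∃ u : List A, u.Perm v ∧ f (u ++ [b, c]) = g (v ++ [c, b]) ∧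
      f (u ++ [b, c]) = g (v ++ [b, c]) := by
  obtain ⟨u, hu, H⟩ := exists_spelling hn hp b hv
  have hlen := hp.length_eq
  have hubc := nodup_append_of_perm hvn hu (List.Perm.refl _)
  have hvcb := nodup_append_of_perm hvn (List.Perm.refl _) (List.Perm.swap b c [])
  have hul := hu.length_eq
  obtain ⟨a₁, hU₁, hV₁, hW₁⟩ := H [b, c, c] rfl
  obtain ⟨a₂, hU₂, hV₂, hW₂⟩ := H [b, b, c] rfl
  simp only [List.map_cons, List.map_nil, List.cons.injEq, and_true] at hW₁ hW₂
  refine ⟨u, hu, ?_, ?_⟩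
  · refine h.apply a₁ ?_ ?_ ?_
    · simpa [hU₁, hW₁] using firstOcc_of_dup (l₁ := u ++ [b, c]) (l₂ := []) (x := c) (by simp)
        (by simpa using hubc)
    · simpa [hV₁, hW₁] using firstOcc_of_dup (l₁ := v ++ [c, b]) (l₂ := []) (x := c) (by simp)
        (by simpa using hvcb)
    · simp; omega
  · refine h.apply a₂ ?_ ?_ ?_
    · simpa [hU₂, hW₂] using firstOcc_of_dup (l₁ := u ++ [b]) (l₂ := [c]) (x := b) (by simp)
        (by simpa using hubc)
    · simpa [hV₂, hW₂] using firstOcc_of_dup (l₁ := v ++ [b]) (l₂ := [c]) (x := b) (by simp)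
        (by simpa using hvn)
    · simp; omega

/-- Identifying `p` with `q`, or `x` with `y`, can spell the same word on the left; the two words on
the right differ by a rotation of three letters. -/
theorem LevelRel.rotate_last {p q x y : ι}
    (h : LevelRel r f g (U ++ [p, q, x, y]) (V ++ [q, p, y, x]))
    (hn : (U ++ [p, q, x, y]).Nodup) (hp : U.Perm V) (hr : U.length + 3 = r) {v : List A}
    {b c d : A} (hv : v.length = V.length) (hvn : (v ++ [b, c, d]).Nodup) :
    g (v ++ [b, c, d]) = g (v ++ [d, b, c]) := by
  obtain ⟨u, hu, H⟩ := exists_spelling hn hp b hv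
  have hlen := hp.length_eq
  have hubc := nodup_append_of_perm hvn hu ((List.Perm.swap c d []).cons b)
  have hvdbc := nodup_append_of_perm hvn (List.Perm.refl _)
    ((List.Perm.swap b d [c]).trans ((List.Perm.swap c d []).cons b))
  have hul := hu.length_eq
  obtain ⟨a₁, hU₁, hV₁, hW₁⟩ := H [b, b, d, c] rfl
  obtain ⟨a₂, hU₂, hV₂, hW₂⟩ := H [b, d, c, c] rfl
  simp only [List.map_cons, List.map_nil, List.cons.injEq, and_true] at hW₁ hW₂
  have h₁ : f (u ++ [b, d, c]) = g (v ++ [b, c, d]) := by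
    refine h.apply a₁ ?_ ?_ ?_
    · simpa [hU₁, hW₁] using firstOcc_of_dup (l₁ := u ++ [b]) (l₂ := [d, c]) (x := b) (by simp)
        (by simpa using hubc)
    · simpa [hV₁, hW₁] using firstOcc_of_dup (l₁ := v ++ [b]) (l₂ := [c, d]) (x := b) (by simp)
        (by simpa using hvn)
    · simp; omega
  have h₂ : f (u ++ [b, d, c]) = g (v ++ [d, b, c]) := by
    refine h.apply a₂ ?_ ?_ ?_
    · simpa [hU₂, hW₂] using firstOcc_of_dup (l₁ := u ++ [b, d, c]) (l₂ := []) (x := c)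
        (by simp) (by simpa using hubc)
    · simpa [hV₂, hW₂] using firstOcc_of_dup (l₁ := v ++ [d, b, c]) (l₂ := []) (x := c)
        (by simp) (by simpa using hvdbc)
    · simp; omega
  rw [← h₁, h₂]

/-- The value of `g`, recorded only on repetition-free words. -/
def guarded (g : List A → C) (l : List A) : Option C :=
  if l.Nodup then some (g l) else none

/-- Guarded values are `none` on both sides when a letter repeats. Symmetries then hold for
arbitrary letters and can be composed without tracking distinctness. -/
theorem guarded_congr {l l' : List A} (hp : l.Perm l') (h : l.Nodup → g l = g l') :
    guarded g l = guarded g l' := by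
  simp only [guarded, ← hp.nodup_iff]
  split_ifs with hl
  · rw [h hl]
  · rfl

theorem eq_of_guarded {l l' : List A} (hl : l.Nodup) (hp : l.Perm l')
    (h : guarded g l = guarded g l') : g l = g l' := by
  simpa [guarded, hl, hp.nodup_iff.1 hl] using h

end Spelling

/-! ### Permutations generated by rotations and swaps -/

section Words

variable {A : Type u} {C : Type v}

theorem swap_first_of_rotate_swap {G : A → A → A → A → C}
    (hρ : ∀ a b c d, G a b c d = G c a b d) (hτ : ∀ a b c d, G a b c d = G a b d c)
    (a b c d : A) : G a b c d = G b a c d := by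
  rw [hρ a b c d, hτ c a b d, ← hρ a d c b, hτ a d c b, hρ a d b c, hτ b a d c]

theorem swap_middle_of_rotate_swap {G : A → A → A → A → C}
    (hρ : ∀ a b c d, G a b c d = G c a b d) (hτ : ∀ a b c d, G a b c d = G a b d c)
    (a b c d : A) : G a b c d = G a c b d := by
  rw [hτ a b c d, hρ a b d c, hτ d a b c, ← hρ a c d b, hτ a c d b]

theorem swap_last_of_swap_rotate {G : A → A → A → A → C}
    (hτ : ∀ a b c d, G a b c d = G b a c d) (hρ : ∀ a b c d, G a b c d = G a d b c)
    (a b c d : A) : G a b c d = G a b d c := by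
  rw [hτ a b c d, hρ b a c d, hτ b d a c, ← hρ d a c b, hτ d a c b, hρ a d c b]

/-- The 3-cycles on places 1–3 and 3–5 generate the alternating group on five places, which contains
every product of two disjoint transpositions. -/
theorem double_swap_of_rotations {G : A → A → A → A → A → C}
    (h₁ : ∀ a b c d e, G a b c d e = G c a b d e) (h₂ : ∀ a b c d e, G a b c d e = G a b e c d)
    (a b c d e : A) : G a b c d e = G a c b e d := by
  rw [h₂ a b c d e, h₁ a b e c d, ← h₂ e a c d b, ← h₁ a c e d b, h₂ a c e d b]

end Words

/-! ### The last blocks of the two words -/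

section Blocks

variable {A : Type u} {C : Type v} {ι : Type w} [DecidableEq A] [DecidableEq ι]
variable {r : ℕ} {f g : List A → C} {U V : List ι}

theorem eq_of_freeze_eq {π : List A → List A} {n : ℕ} {l l' s : List A}
    (h : freeze π n g l = freeze π n g l') (hn : (l ++ s).Nodup) (hp : l.Perm l')
    (hs : s.length = n) : g (l ++ π s) = g (l' ++ π s) := by
  have := congrFun h s
  simpa [freeze, hn, (hp.append_right s).nodup_iff.1 hn, hs] using this

/-- The pieces after the cut of `LevelRel.exists_split` carry the same labels. They end equally, or
are a swapped pair, or have at least three labels with different ends. -/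
theorem LevelRel.last_blocks (h : LevelRel r f g U V) (hn : U.Nodup) (hp : U.Perm V)
    (hlen : U.length = r + 1) (hr : 1 ≤ r) :
    (∃ U₁ V₁ t, U = U₁ ++ [t] ∧ V = V₁ ++ [t] ∧ U₁.Perm V₁) ∨
    (∃ U₁ V₁ a b, U = U₁ ++ [a, b] ∧ V = V₁ ++ [b, a] ∧ U₁.Perm V₁) ∨
    ∃ U₁ V₁ W₀ W₁ l k, U = U₁ ++ (W₀ ++ [l]) ∧ V = V₁ ++ (W₁ ++ [k]) ∧ U₁.Perm V₁ ∧
      (W₀ ++ [l]).Perm (W₁ ++ [k]) ∧ l ≠ k ∧ 2 ≤ W₀.length ∧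
      TailInv r U₁.length f ∧ TailInv r U₁.length g := by
  obtain ⟨p, hpr, hf, hg, hperm⟩ := h.exists_split hn hp hlen hr
  have hlen' := hp.length_eq
  have hUe := List.take_append_drop p U
  have hVe := List.take_append_drop p V
  have hUl : (U.take p).length = p := by simp; omega
  have hVl : (V.take p).length = p := by simp; omega
  have hWl : (U.drop p).length + p = r + 1 := by simp; omega
  have hW : (U.drop p).Perm (V.drop p) := by
    rw [← hUe, ← hVe] at hp
    exact (List.perm_append_left_iff _).1 (hp.trans (hperm.symm.append_right _))
  generalize U.take p = U₁ at *
  generalize V.take p = V₁ at *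
  generalize U.drop p = W at *
  generalize V.drop p = W' at *
  subst hUl
  rcases List.eq_nil_or_concat W with rfl | ⟨W₀, l, rfl⟩
  · simp at hWl; omega
  rcases List.eq_nil_or_concat W' with rfl | ⟨W₁, k, rfl⟩
  · simpa using hW.length_eq
  rw [List.concat_eq_append, List.concat_eq_append] at *
  by_cases hlk : l = k
  · subst hlk
    refine Or.inl ⟨U₁ ++ W₀, V₁ ++ W₁, l, by simp [← hUe], by simp [← hVe], ?_⟩
    exact hperm.append ((List.perm_append_right_iff _).1 hW)
  have hll := hW.length_eq
  simp only [List.length_append, List.length_singleton] at hll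
  match W₀, hll with
  | [], hll =>
    obtain rfl := List.length_eq_zero_iff.1 (show W₁.length = 0 by
      simp only [List.length_nil] at hll; omega)
    simp at hW
    exact absurd hW hlk
  | [a], hll =>
    obtain ⟨b, rfl⟩ := List.length_eq_one_iff.1 (show W₁.length = 1 by simp at hll; omega)
    have hn2 : (([a] ++ [l] : List ι)).Nodup := by
      rw [← hUe] at hn
      exact (List.nodup_append.1 hn).2.1
    have hk : k ∈ [a] ++ [l] := hW.mem_iff.2 (by simp)
    have hl : l ∈ [b] ++ [k] := hW.mem_iff.1 (by simp)
    have hka : k = a := by simpa [Ne.symm hlk] using hk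
    have hlb : l = b := by simpa [hlk] using hl
    subst hka hlb
    exact Or.inr (Or.inl ⟨U₁, V₁, k, l, by simp [← hUe], by simp [← hVe], hperm⟩)
  | a :: b :: W₀, hll =>
    exact Or.inr (Or.inr ⟨U₁, V₁, a :: b :: W₀, W₁, l, k, hUe.symm, hVe.symm, hperm, hW, hlk,
      by simp, hf, hg⟩)

/-- Identifying `l` with `k`, or `x` with `y`, gives a 3-cycle through one block place and the two
final places. Together with the symmetry `hmid` inside the block, which has at least two letters, it
generates the swap of the last two. -/
theorem LevelRel.swap_last_of_long_block {U₁ V₁ W₀ W₁ : List ι} {l k x y : ι}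
    (h : LevelRel r f g (U₁ ++ (W₀ ++ [l]) ++ [x, y]) (V₁ ++ (W₁ ++ [k]) ++ [y, x]))
    (hn : (U₁ ++ (W₀ ++ [l]) ++ [x, y]).Nodup) (hp : U₁.Perm V₁)
    (hW : (W₀ ++ [l]).Perm (W₁ ++ [k])) (hlk : l ≠ k) (hW₀ : 2 ≤ W₀.length)
    (hr : U₁.length + W₀.length + 2 = r)
    (hmid : ∀ (v N N' : List A) (b c : A), v.length = U₁.length → N.length = W₀.length →
      N.Perm N' → (v ++ N ++ [b, c]).Nodup → g (v ++ N ++ [b, c]) = g (v ++ N' ++ [b, c]))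
    {v M : List A} {b c : A} (hv : v.length = U₁.length) (hM : M.length = W₀.length)
    (hvn : (v ++ M ++ [b, c]).Nodup) : g (v ++ M ++ [b, c]) = g (v ++ M ++ [c, b]) := by
  have hkW : k ∈ W₀ := by
    have : k ∈ W₀ ++ [l] := hW.mem_iff.2 (by simp)
    simpa [Ne.symm hlk] using this
  have hW₀' : W₀.Perm (k :: W₀.erase k) := List.perm_cons_erase hkW
  have hW₁' : W₁.Perm (l :: W₀.erase k) := by
    refine (List.perm_append_right_iff [k]).1 (hW.symm.trans ?_)
    refine (hW₀'.append_right _).trans ?_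
    refine (List.Perm.cons k (List.perm_append_singleton l _)).trans ?_
    exact (List.perm_append_singleton k _).symm
  generalize W₀.erase k = W at *
  have hWl : W.length + 1 = W₀.length := by simpa using hW₀'.length_eq.symm
  have hlabels : (U₁ ++ (k :: W ++ [l, x, y])).Nodup := by
    refine List.Perm.nodup ?_ hn
    simpa using (hW₀'.append_right [l, x, y]).append_left U₁
  -- the two ways of spelling a word by identifying labels inside the block or after it
  have hrel : ∀ (N : List A) (e z d : A), N.length = W.length →
      (v ++ (e :: N) ++ [z, d]).Nodup →
      g (v ++ (e :: N) ++ [z, d]) = g (v ++ (d :: N) ++ [e, z]) := by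
    intro N e z d hN hnd
    obtain ⟨u, hu, H⟩ := exists_spelling hlabels hp e (v := v) (by rw [hv, hp.length_eq])
    obtain ⟨a₁, hU₁, hV₁, hS₁⟩ := H (e :: N ++ [e, d, z]) (by simp [hN])
    obtain ⟨a₂, hU₂, hV₂, hS₂⟩ := H (e :: N ++ [d, z, z]) (by simp [hN])
    rw [List.map_append] at hS₁ hS₂
    obtain ⟨hk₁, ht₁⟩ := List.append_inj hS₁ (by simp [hN])
    obtain ⟨hk₂, ht₂⟩ := List.append_inj hS₂ (by simp [hN])
    have hk₁' := hk₁
    have hk₂' := hk₂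
    simp only [List.map_cons, List.map_nil, List.cons.injEq, and_true] at ht₁ ht₂ hk₁' hk₂'
    have hWa : W₀.map a₁ = W₀.map a₂ := map_eq_map_of_perm hW₀' (hk₁.trans hk₂.symm)
    have hX : (W₀.map a₂).Perm (e :: N) := by rw [← hk₂]; exact hW₀'.map a₂
    have hY : (W₁.map a₂).Perm (d :: N) := by
      refine (hW₁'.map a₂).trans ?_
      rw [List.map_cons, ht₂.1, hk₂'.2]
    have hul := hu.length_eq
    have hleft : (u ++ W₀.map a₂ ++ [d, z]).Nodup :=
      nodup_append_of_perm hnd (hu.append hX) (List.Perm.swap z d [])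
    have hright : (v ++ W₁.map a₂ ++ [e, z]).Nodup := by
      refine List.Perm.nodup ?_ hnd
      rw [List.append_assoc, List.append_assoc]
      refine List.Perm.append_left v ?_
      refine List.Perm.trans ?_ (hY.symm.append_right _)
      simp only [List.cons_append]
      refine List.Perm.trans ?_ (((List.perm_middle (a := e) (l₁ := N) (l₂ := [z])).cons d).symm)
      refine List.Perm.trans ?_ (List.Perm.swap _ _ _)
      refine List.Perm.cons e ?_
      have : ([z, d] : List A).Perm [d, z] := List.Perm.swap _ _ _
      exact (this.append_left N).trans List.perm_middle
    have h₂ : f (u ++ W₀.map a₂ ++ [d, z]) = g (v ++ W₁.map a₂ ++ [e, z]) := by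
      refine h.apply a₂ ?_ ?_ ?_
      · simpa [hU₂, ht₂] using firstOcc_of_dup (l₁ := u ++ W₀.map a₂ ++ [d, z]) (l₂ := [])
          (x := z) (by simp) (by simpa using hleft)
      · simpa [hV₂, ht₂, hk₂'] using firstOcc_of_dup (l₁ := v ++ W₁.map a₂ ++ [e, z])
          (l₂ := []) (x := z) (by simp) (by simpa using hright)
      · simp; omega
    have hX₁ : (firstOcc ((W₁ ++ [k]).map a₁)).Perm (e :: N) := by
      rw [List.perm_ext_iff_of_nodup (firstOcc_nodup _)
        (List.nodup_append.1 (List.nodup_append.1 hnd).1).2.1]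
      intro q
      have := ((hW.symm.map a₁).mem_iff (a := q))
      rw [mem_firstOcc, this, List.map_append, hWa, List.mem_append, hX.mem_iff]
      simp only [List.map_cons, List.map_nil, ht₁, List.mem_cons, List.not_mem_nil, or_false]
      tauto
    have h₁ : f (u ++ W₀.map a₂ ++ [d, z]) =
        g (v ++ firstOcc ((W₁ ++ [k]).map a₁) ++ [z, d]) := by
      refine h.apply a₁ ?_ ?_ ?_
      · have : e ∈ u ++ W₀.map a₂ := by
          rw [List.mem_append]
          exact Or.inr (hX.mem_iff.2 (by simp))
        simpa [hU₁, hWa, ht₁] using firstOcc_of_dup (l₁ := u ++ W₀.map a₂) (l₂ := [d, z])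
          (x := e) this hleft
      · have hnd' := nodup_append_of_perm hnd (hX₁.append_left v) (List.Perm.refl _)
        have hd := List.nodup_append.1 hnd'
        have hd' := List.nodup_append.1 hd.1
        rw [List.map_append, List.map_append, hV₁]
        simp only [List.map_cons, List.map_nil, ht₁]
        rw [firstOcc_append_of_nodup hd.2.1, firstOcc_append, firstOcc_of_nodup hd'.1,
          List.filter_eq_self.2]
        · intro q hq
          simp only [decide_eq_true_eq]
          exact fun hqv => hd'.2.2 q hqv q hq rfl
        · intro q hq hq'
          refine hd.2.2 q ?_ q hq rfl
          rw [List.mem_append] at hq' ⊢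
          exact hq'.imp_right mem_firstOcc.2
      · have := hX.length_eq
        simp at this
        simp; omega
    rw [← hmid v _ (e :: N) z d hv (by rw [hX₁.length_eq]; simp; omega) hX₁
      (nodup_append_of_perm hnd (hX₁.append_left v) (List.Perm.refl _)), ← h₁, h₂]
    exact hmid v _ (d :: N) e z hv (by rw [hY.length_eq]; simp; omega) hY hright
  match M, hM, hvn with
  | [], hM, _ => simp at hM; omega
  | [_], hM, _ => simp at hM; omega
  | p :: q :: N, hM, hvn =>
    let G : A → A → A → A → Option C := fun a b c d => guarded g (v ++ (a :: b :: N) ++ [c, d])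
    have hNl : N.length + 1 = W.length := by simp at hM; omega
    have hsym : ∀ a b c d, G a b c d = G b a c d := by
      intro a b c d
      have hab : (a :: b :: N).Perm (b :: a :: N) := List.Perm.swap _ _ _
      refine guarded_congr ((hab.append_left v).append_right _) fun hnd => ?_
      exact hmid v _ _ c d hv (by simp at hM ⊢; omega) hab hnd
    have hrel' : ∀ a b c d, G a b c d = G d b a c := by
      intro a b c d
      refine guarded_congr ?_ fun hnd => ?_
      · rw [List.append_assoc, List.append_assoc]
        refine List.Perm.append_left v ?_
        simp only [List.cons_append]
        have h₁ : (a :: b :: (N ++ [c, d])).Perm ((b :: N) ++ a :: [c, d]) :=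
          (List.perm_middle (a := a) (l₁ := b :: N) (l₂ := [c, d])).symm
        have h₂ : ((b :: N) ++ a :: [c, d]).Perm ((b :: N) ++ d :: [a, c]) := by
          refine List.Perm.append_left _ ?_
          exact ((List.Perm.swap d c []).cons a).trans (List.Perm.swap d a [c])
        exact h₁.trans (h₂.trans List.perm_middle)
      · exact hrel (b :: N) a c d (by simp; omega) hnd
    have hexch : ∀ a b c d, G a b c d = G a c b d := by
      intro a b c d
      rw [← hrel' c b d a, hsym c b d a, hrel' b c d a]
    have hG : G p q b c = G p q c b := by
      rw [hrel' p q b c, hsym c q p b, hexch q c p b, hsym q p c b]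
    refine eq_of_guarded hvn ?_ hG
    exact (List.Perm.swap c b []).append_left _

end Blocks

/-! ### Pairwise swapped words -/

section PairSwap

variable {ι : Type w}

/-- `V` arises from `U` by swapping consecutive pairs of entries, counted from the end; if the
length is odd, then the first entry stays in place. -/
inductive PairSwap : List ι → List ι → Prop
  | nil : PairSwap [] []
  | single (x : ι) : PairSwap [x] [x]
  | snoc {U V : List ι} (x y : ι) : PairSwap U V → PairSwap (U ++ [x, y]) (V ++ [y, x])

theorem PairSwap.perm {U V : List ι} (h : PairSwap U V) : U.Perm V := by
  induction h with
  | nil => exact List.Perm.refl _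
  | single x => exact List.Perm.refl _
  | snoc x y _ ih => exact ih.append (List.Perm.swap _ _ _)

theorem PairSwap.eq_or_snoc {U V : List ι} (h : PairSwap U V) :
    (U = V ∧ U.length ≤ 1) ∨ ∃ U₁ V₁ x y, U = U₁ ++ [x, y] ∧ V = V₁ ++ [y, x] ∧ PairSwap U₁ V₁ := by
  cases h with
  | nil => simp
  | single x => simp
  | snoc x y h => exact Or.inr ⟨_, _, x, y, rfl, rfl, h⟩

theorem pairSwap_of_length_le_one {U V : List ι} (h : U.Perm V) (hU : U.length ≤ 1) :
    PairSwap U V := by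
  match U, hU with
  | [], _ => obtain rfl := h.nil_eq; exact .nil
  | [x], _ => obtain rfl := List.singleton_perm.1 h; exact .single x

theorem not_pairSwap_of_last_eq {U V : List ι} {M : ι} (hn : (U ++ [M]).Nodup) (hU : U ≠ []) :
    ¬ PairSwap (U ++ [M]) (V ++ [M]) := by
  intro h
  rcases h.eq_or_snoc with ⟨_, hl⟩ | ⟨U₁, V₁, x, y, hU₁, hV₁, -⟩
  · simp at hl; exact hU hl
  · have hx : U₁ ++ [x, y] = (U₁ ++ [x]) ++ [y] := by simp
    have hy : V₁ ++ [y, x] = (V₁ ++ [y]) ++ [x] := by simp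
    rw [hx] at hU₁
    rw [hy] at hV₁
    obtain ⟨rfl, hM⟩ := List.append_inj' hU₁ rfl
    obtain ⟨rfl, hM'⟩ := List.append_inj' hV₁ rfl
    simp only [List.cons.injEq, and_true] at hM hM'
    subst hM hM'
    simp [List.nodup_append] at hn

end PairSwap

/-! ### Agreement when the words are not pairwise swapped -/

section Main

variable {A : Type u} {ι : Type w} [DecidableEq A] [DecidableEq ι]

/-- The reconstruction property for words of `m` labels that are not pairwise swapped, at the
level of `m - 1` letters. -/
def Solvable (A : Type u) (ι : Type w) [DecidableEq A] [DecidableEq ι] (m : ℕ) : Prop :=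
  ∀ (C : Type (max u v)) (r : ℕ) (f g : List A → C) (U V : List ι), U.length = m → m = r + 1 →
    U.Nodup → U.Perm V → LevelRel r f g U V → ¬ PairSwap U V →
    Agree r f g ∧ ∀ U₁ V₁ x y, U = U₁ ++ [x, y] → V = V₁ ++ [y, x] →
      ∀ (l : List A) (b c : A), l.length + 2 = r → (l ++ [b, c]).Nodup →
        g (l ++ [b, c]) = g (l ++ [c, b])

variable {C : Type (max u v)} {r : ℕ} {f g : List A → C}

theorem exists_eq_append_pair {l : List A} (h : 2 ≤ l.length) : ∃ v b c, l = v ++ [b, c] := by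
  rcases List.eq_nil_or_concat l with rfl | ⟨l, c, rfl⟩
  · simp at h
  rcases List.eq_nil_or_concat l with rfl | ⟨l, b, rfl⟩
  · simp at h
  exact ⟨l, b, c, by simp⟩

theorem Solvable.agree_of_last_eq_of_not_pairSwap {U V : List ι} {M : ι} (IH : Solvable.{u, v, w} A ι r)
    (h : LevelRel r f g (U ++ [M]) (V ++ [M])) (hn : (U ++ [M]).Nodup) (hp : U.Perm V)
    (hr : U.length = r) (hU : ¬ PairSwap U V) : Agree r f g := by
  have hlen : 2 ≤ U.length := by
    by_contra hlt
    exact hU (pairSwap_of_length_le_one hp (by omega))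
  obtain ⟨s, rfl⟩ : ∃ s, r = s + 1 := ⟨r - 1, by omega⟩
  -- Freezing changes the codomain to `List A → Option C`, which is why `Solvable` quantifies over
  -- all codomains in a universe large enough for this.
  have h' := h.freeze (π := id) hn hp rfl (fun _ => rfl) (fun _ _ => List.Perm.refl _)
  have hA := (IH _ s _ _ U V hr rfl (List.nodup_append.1 hn).1 hp h' hU).1
  intro l hl hlr
  rcases List.eq_nil_or_concat l with rfl | ⟨l, z, rfl⟩
  · simp at hlr
  · rw [List.concat_eq_append] at *
    exact hA.of_freeze hl (by simpa using hlr) rfl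

/-- The fixed last label `M` gives a swap of the last two letters. Freezing `M` gives a rotation of
the three letters before the last. Together they generate all permutations of the last four letters.
-/
theorem LevelRel.tailInv_of_pairs {U V : List ι} {p q x y M : ι}
    (h : LevelRel r f g (U ++ [p, q, x, y, M]) (V ++ [q, p, y, x, M]))
    (hn : (U ++ [p, q, x, y, M]).Nodup) (hp : U.Perm V) (hr : U.length + 4 = r) :
    TailInv r U.length g := by
  have hlen := hp.length_eq
  have hτ' : ∀ (l : List A) (b c : A), l.length + 2 = r → (l ++ [b, c]).Nodup →
      g (l ++ [b, c]) = g (l ++ [c, b]) := by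
    intro l b c hl hlb
    have h₁ : LevelRel r f g ((U ++ [p, q]) ++ [x, y, M]) ((V ++ [q, p]) ++ [y, x, M]) := by
      simpa using h
    obtain ⟨u, -, h₂, h₃⟩ := h₁.swap_last_of_fixed_after (by simpa using hn)
      (hp.append (List.Perm.swap _ _ _)) (by simp; omega) (by simp; omega) hlb
    rw [← h₂, h₃]
  subst hr
  have hρ' : ∀ (l : List A) (a b c d : A), l.length = U.length → (l ++ [a, b, c, d]).Nodup →
      g (l ++ [a, b, c, d]) = g (l ++ [c, a, b, d]) := by
    intro l a b c d hl hn'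
    have h₁ : LevelRel (U.length + 3 + 1) f g ((U ++ [p, q, x, y]) ++ [M])
        ((V ++ [q, p, y, x]) ++ [M]) := by simpa using h
    have h₂ := h₁.freeze (π := id) (by simpa using hn)
      (hp.append ((List.Perm.swap q p _).trans (((List.Perm.swap y x []).cons p).cons q)))
      rfl (fun _ => rfl) (fun _ _ => List.Perm.refl _)
    have hn'' : (l ++ [a, b, c] ++ [d]).Nodup := by simpa using hn'
    have hn₁ : (U ++ [p, q, x, y]).Nodup := by
      refine (List.nodup_append (l₂ := [M]).1 ?_).1
      simpa using hn
    have h₃ := h₂.rotate_last hn₁ hp rfl (by omega) (List.nodup_append.1 hn'').1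
    have := eq_of_freeze_eq h₃ hn'' (((List.Perm.swap c b []).cons a).trans
      (List.Perm.swap c a [b]) |>.append_left l) rfl
    simpa using this
  refine tailInv_of_swap fun l z b c hl hlr hnd => ?_
  set n := U.length with hndef
  clear_value n
  have hG : ∀ l₀ : List A, l₀.length = n →
      (∀ a b c d, guarded g (l₀ ++ [a, b, c, d]) = guarded g (l₀ ++ [c, a, b, d])) ∧
      ∀ a b c d, guarded g (l₀ ++ [a, b, c, d]) = guarded g (l₀ ++ [a, b, d, c]) := by
    intro l₀ hl₀
    constructor
    · intro a b c d
      refine guarded_congr (List.Perm.append_left l₀ ?_) (hρ' l₀ a b c d hl₀)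
      exact ((List.Perm.swap c b [d]).cons a).trans (List.Perm.swap c a [b, d])
    · intro a b c d
      refine guarded_congr (List.Perm.append_left l₀ ?_) fun hnd => ?_
      · exact (((List.Perm.swap d c []).cons b).cons a)
      · have := hτ' (l₀ ++ [a, b]) c d (by simp; omega) (by simpa using hnd)
        simpa using this
  have hsw : ∀ {l z : List A} {b c : A}, (l ++ b :: c :: z).Perm (l ++ c :: b :: z) :=
    (List.Perm.swap _ _ _).append_left _
  refine eq_of_guarded hnd hsw ?_
  simp only [List.length_append, List.length_cons] at hlr
  match z, hlr with
  | [d, e], hlr =>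
    obtain ⟨h₁, h₂⟩ := hG l (by simp at hlr; omega)
    exact swap_first_of_rotate_swap (G := fun a b c d => guarded g (l ++ [a, b, c, d])) h₁ h₂ _ _ _ _
  | [d], hlr =>
    rcases List.eq_nil_or_concat l with rfl | ⟨l, e, rfl⟩
    · simp at hlr
    · simp only [List.length_concat, List.length_singleton] at hlr
      obtain ⟨h₁, h₂⟩ := hG l (by omega)
      have := swap_middle_of_rotate_swap (G := fun a b c d => guarded g (l ++ [a, b, c, d]))
        h₁ h₂ e b c d
      simpa using this
  | [], hlr =>
    refine guarded_congr hsw fun _ => hτ' l b c (by simp at hlr; omega) hnd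
  | _ :: _ :: _ :: _, hlr => simp at hlr; omega

/-- If `U` and `V` are pairwise swapped, freezing `M` alone would lead to the exceptional case. With
at least two pairs, `LevelRel.tailInv_of_pairs` allows the last pair of `V` to be put back in the
order of `U`; before `M` both words then end in the same label and are not pairwise swapped. -/
theorem Solvable.agree_of_last_eq {U V : List ι} {M : ι} (IH : Solvable.{u, v, w} A ι r)
    (h : LevelRel r f g (U ++ [M]) (V ++ [M])) (hn : (U ++ [M]).Nodup) (hp : U.Perm V)
    (hr : U.length = r) (hr1 : 1 ≤ r) : Agree r f g := by
  by_cases hUV : PairSwap U V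
  swap
  · exact IH.agree_of_last_eq_of_not_pairSwap h hn hp hr hUV
  have hlen := hp.length_eq
  rcases hUV.eq_or_snoc with ⟨rfl, hl⟩ | ⟨U₁, V₁, x, y, rfl, rfl, hUV₁⟩
  · intro l hl' hlr
    obtain ⟨t, rfl⟩ := List.length_eq_one_iff.1 (show U.length = 1 by omega)
    obtain ⟨b, rfl⟩ := List.length_eq_one_iff.1 (show l.length = 1 by simp at hr; omega)
    exact h.apply (fun _ => b) (by simp [firstOcc]) (by simp [firstOcc]) hlr
  rw [List.append_assoc] at hn
  rw [List.append_assoc, List.append_assoc] at h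
  simp only [List.cons_append, List.nil_append] at h hn
  have hlen₁ := hUV₁.perm.length_eq
  rcases hUV₁.eq_or_snoc with ⟨rfl, hl⟩ | ⟨U₂, V₂, p, q, rfl, rfl, hUV₂⟩
  · intro l hl' hlr
    simp only [List.length_append, List.length_cons, List.length_nil] at hr
    obtain ⟨v, b, c, rfl⟩ := exists_eq_append_pair (show 2 ≤ l.length by omega)
    simp only [List.length_append, List.length_cons, List.length_nil] at hlr
    obtain ⟨u, hu, -, h₂⟩ := h.swap_last_of_fixed_after hn (List.Perm.refl _) (by omega)
      (by omega) hl'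
    have hvl : v.length ≤ 1 := by omega
    have huv : u = v := by
      match v, hvl with
      | [], _ => exact hu.eq_nil
      | [d], _ => exact List.perm_singleton.1 hu
    rw [huv] at h₂
    exact h₂
  · have hp₂ := hUV₂.perm
    rw [List.append_assoc] at hn
    rw [List.append_assoc, List.append_assoc] at h
    simp only [List.cons_append, List.nil_append] at h hn
    simp only [List.length_append, List.length_cons, List.length_nil] at hr
    have hT := h.tailInv_of_pairs hn hp₂ (by omega)
    have hfull : (U₂ ++ [p, q, x, y, M]).Perm (V₂ ++ [q, p, y, x, M]) :=
      hp₂.append ((List.Perm.swap q p _).trans (((List.Perm.swap y x _).cons p).cons q))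
    have h₁ : LevelRel r f g (U₂ ++ [p, q, x, y, M]) ((V₂ ++ [q]) ++ [p, y, x, M]) := by
      simpa using h
    have h₂ := h₁.permute_tail (V₂' := [p, x, y, M]) (by simpa using hfull) (by simp; omega) hT
      (by simp [hp₂.length_eq]) ((List.Perm.swap _ _ _).cons p)
    have h₃ : LevelRel r f g ((U₂ ++ [p, q, x] ++ [y]) ++ [M]) ((V₂ ++ [q, p, x] ++ [y]) ++ [M]) := by
      simpa using h₂
    have hn₃ : ((U₂ ++ [p, q, x] ++ [y]) ++ [M]).Nodup := by simpa using hn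
    refine IH.agree_of_last_eq_of_not_pairSwap h₃ hn₃ ((hp₂.append (List.Perm.swap q p _)).append_right _)
      (by simp; omega) (not_pairSwap_of_last_eq (List.nodup_append.1 hn₃).1 (by simp))

end Main

section Main

variable {A : Type u} {ι : Type w} [DecidableEq A] [DecidableEq ι]
variable {C : Type (max u v)} {r : ℕ} {f g : List A → C}

/-- The block preceding the swapped pair supplies the symmetry. After a swapped pair, the second
clause of the induction hypothesis swaps the two letters before the last two, and
`LevelRel.rotate_last` rotates the last three. -/
theorem swap_last_of_not_pairSwap {U V : List ι} {x y : ι}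
    (IH : Agree r (freeze id 2 f) (freeze List.reverse 2 g) ∧
      ∀ U₁ V₁ x y, U = U₁ ++ [x, y] → V = V₁ ++ [y, x] →
        ∀ (l : List A) (b c : A), l.length + 2 = r → (l ++ [b, c]).Nodup →
          freeze List.reverse 2 g (l ++ [b, c]) = freeze List.reverse 2 g (l ++ [c, b]))
    (h : LevelRel (r + 2) f g (U ++ [x, y]) (V ++ [y, x])) (hn : (U ++ [x, y]).Nodup)
    (hp : U.Perm V) (hr : U.length = r + 1) (hr1 : 1 ≤ r) (hUV : ¬ PairSwap U V) (l : List A)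
    (b c : A) (hl : l.length = r) (hnd : (l ++ [b, c]).Nodup) :
    g (l ++ [b, c]) = g (l ++ [c, b]) := by
  have hlen := hp.length_eq
  have hnU := (List.nodup_append.1 hn).1
  have h' := h.freeze (π := List.reverse) hn hp rfl (fun _ => by simp)
    (fun s _ => List.reverse_perm s)
  rcases h'.last_blocks hnU hp hr hr1 with ⟨U₁, V₁, t, rfl, rfl, hp₁⟩ |
    ⟨U₁, V₁, p, q, rfl, rfl, hp₁⟩ | ⟨U₁, V₁, W₀, W₁, s, k, rfl, rfl, hp₁, hW, hsk, hW₀, -, hg⟩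
  · simp only [List.append_assoc, List.cons_append, List.nil_append] at h hn
    simp only [List.length_append, List.length_cons, List.length_nil] at hr hlen
    refine h.swap_last_of_fixed_before hn hp₁ ?_ (by omega) (by omega) hnd
    rintro rfl
    simp at hr; omega
  · have hτ' := IH.2 U₁ V₁ p q rfl rfl
    simp only [List.append_assoc, List.cons_append, List.nil_append] at h hn
    simp only [List.length_append, List.length_cons, List.length_nil] at hr hlen
    have hU₁ : 1 ≤ U₁.length := by
      by_contra hlt
      exact hUV ((pairSwap_of_length_le_one hp₁ (by omega)).snoc _ _)
    obtain ⟨v, d, e, rfl⟩ := exists_eq_append_pair (show 2 ≤ l.length by omega)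
    simp only [List.length_append, List.length_cons, List.length_nil] at hl
    let G : A → A → A → A → Option C := fun a b c d => guarded g (v ++ [a, b, c, d])
    have hτ : ∀ a b c d, G a b c d = G b a c d := by
      intro a b c d
      refine guarded_congr (List.Perm.append_left v (List.Perm.swap _ _ _)) fun hn' => ?_
      have hn'' : (v ++ [a, b] ++ [d, c]).Nodup := by
        refine List.Perm.nodup ?_ hn'
        simpa using List.Perm.append_left v (((List.Perm.swap d c []).cons b).cons a)
      have := eq_of_freeze_eq (hτ' v a b (by omega) (List.nodup_append.1 hn'').1) hn''
        (List.Perm.append_left v (List.Perm.swap _ _ _)) rfl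
      simpa using this
    have hρ : ∀ a b c d, G a b c d = G a d b c := by
      intro a b c d
      refine guarded_congr (List.Perm.append_left v ?_) fun hn' => ?_
      · exact (((List.Perm.swap d c []).cons b).trans (List.Perm.swap d b [c])).cons a
      · have := h.rotate_last hn hp₁ (by omega) (v := v ++ [a]) (b := b) (c := c) (d := d)
          (by simp; omega) (by simpa using hn')
        simpa using this
    have := swap_last_of_swap_rotate hτ hρ d e b c
    refine eq_of_guarded hnd (List.Perm.append_left _ (List.Perm.swap _ _ _)) ?_
    simpa using this
  · have hWl := hW.length_eq
    simp only [List.length_append, List.length_cons, List.length_nil] at hr hlen hWl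
    have hmid : ∀ (v N N' : List A) (b c : A), v.length = U₁.length → N.length = W₀.length →
        N.Perm N' → (v ++ N ++ [b, c]).Nodup →
        g (v ++ N ++ [b, c]) = g (v ++ N' ++ [b, c]) := by
      intro v N N' b c hv hN hNN hn'
      have hn'' : (v ++ N ++ [c, b]).Nodup :=
        nodup_append_of_perm hn' (List.Perm.refl _) (List.Perm.swap _ _ _)
      have := eq_of_freeze_eq (hg v N N' hv (by simp; omega) (List.nodup_append.1 hn'').1 hNN)
        hn'' (List.Perm.append_left v hNN) rfl
      simpa using this
    have hle : U₁.length ≤ l.length := by omega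
    rw [← List.take_append_drop U₁.length l] at hnd ⊢
    exact h.swap_last_of_long_block hn hp₁ hW hsk hW₀ (by omega) hmid (by simp; omega)
      (by simp; omega) hnd

/-- A swapped final pair is frozen in reversed order, and the missing swap of the last two letters
of `g` comes from `swap_last_of_not_pairSwap`. Otherwise the last labels are equal, or can be made
equal by tail invariance in a long block. -/
theorem solvable (m : ℕ) : Solvable.{u, v, w} A ι m := by
  induction m using Nat.strong_induction_on with
  | _ m IH =>
  intro C r f g U V hm hmr hn hp h hUV
  have hlen : 2 ≤ U.length := by
    by_contra hlt
    exact hUV (pairSwap_of_length_le_one hp (by omega))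
  have hr1 : 1 ≤ r := by omega
  have hVn := hp.nodup_iff.1 hn
  by_cases hsw : ∃ U₁ V₁ x y, U = U₁ ++ [x, y] ∧ V = V₁ ++ [y, x] ∧ U₁.Perm V₁
  · obtain ⟨U₁, V₁, x, y, rfl, rfl, hp₁⟩ := hsw
    have hUV₁ : ¬ PairSwap U₁ V₁ := fun h => hUV (h.snoc x y)
    have hlen₁ : 2 ≤ U₁.length := by
      by_contra hlt
      exact hUV₁ (pairSwap_of_length_le_one hp₁ (by omega))
    simp only [List.length_append, List.length_cons, List.length_nil] at hm
    obtain ⟨s, rfl⟩ : ∃ s, r = s + 2 := ⟨r - 2, by omega⟩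
    have h' := h.freeze (π := List.reverse) hn hp₁ rfl (fun _ => by simp)
      (fun s _ => List.reverse_perm s)
    have IH₁ := IH U₁.length (by omega) _ s _ _ U₁ V₁ rfl (by omega)
      (List.nodup_append.1 hn).1 hp₁ h' hUV₁
    have hsl : ∀ (l : List A) (b c : A), l.length = s → (l ++ [b, c]).Nodup →
        g (l ++ [b, c]) = g (l ++ [c, b]) := fun l b c hl hnd =>
      swap_last_of_not_pairSwap IH₁ h hn hp₁ (by omega) (by omega) hUV₁ l b c hl hnd
    refine ⟨fun l hl hlr => ?_, fun _ _ _ _ _ _ l b c hl hnd => hsl l b c (by omega) hnd⟩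
    obtain ⟨v, b, c, rfl⟩ := exists_eq_append_pair (show 2 ≤ l.length by omega)
    simp only [List.length_append, List.length_cons, List.length_nil] at hlr
    have := IH₁.1.of_freeze hl (by omega) rfl
    simp only [List.reverse_cons, List.reverse_nil, List.nil_append, List.cons_append] at this
    rw [this, hsl v b c (by omega) hl]
  · refine ⟨?_, fun U₁ V₁ x y hU hV => absurd ⟨U₁, V₁, x, y, hU, hV, ?_⟩ hsw⟩
    swap
    · subst hU hV
      refine (List.perm_append_right_iff [x, y]).1 (hp.trans ?_)
      exact List.Perm.append_left _ (List.Perm.swap _ _ _)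
    rcases h.last_blocks hn hp (by omega) hr1 with ⟨U₁, V₁, t, rfl, rfl, hp₁⟩ |
      ⟨U₁, V₁, p, q, hU, hV, hp₁⟩ | ⟨U₁, V₁, W₀, W₁, s, k, rfl, rfl, hp₁, hW, hsk, hW₀, hf, hg⟩
    · simp only [List.length_append, List.length_cons, List.length_nil] at hm
      exact (IH r (by omega)).agree_of_last_eq h hn hp₁ (by omega) hr1
    · exact absurd ⟨U₁, V₁, p, q, hU, hV, hp₁⟩ hsw
    · have hWl := hW.length_eq
      simp only [List.length_append, List.length_cons, List.length_nil] at hm hWl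
      have hlen₁ := hp₁.length_eq
      -- a label that is first in neither of the two blocks
      obtain ⟨c₀, W₂, hW₂⟩ := List.exists_cons_of_length_pos (show 0 < W₀.length by omega)
      obtain ⟨c₁, W₃, hW₃⟩ := List.exists_cons_of_length_pos (show 0 < W₁.length by omega)
      subst hW₂ hW₃
      simp only [List.length_cons] at hm hWl hW₀
      obtain ⟨M, hM, hMc⟩ : ∃ M ∈ W₂ ++ [s], M ≠ c₁ := by
        obtain ⟨d, W₂, rfl⟩ := List.exists_cons_of_length_pos (show 0 < W₂.length by omega)
        by_cases hd : d = c₁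
        · refine ⟨s, by simp, ?_⟩
          rintro rfl
          subst hd
          simp [List.nodup_append] at hn
        · exact ⟨d, by simp, hd⟩
      have hM' : M ∈ W₃ ++ [k] := by
        have : M ∈ c₁ :: W₃ ++ [k] := hW.mem_iff.1 (by
          simp only [List.cons_append, List.mem_cons]; exact Or.inr hM)
        simpa [hMc] using this
      have hperm : ∀ {W : List ι}, M ∈ W → W.Perm (W.erase M ++ [M]) := fun hM =>
        (List.perm_cons_erase hM).trans (List.perm_append_singleton M _).symm
      have e₁ : ∀ (X : List ι) (c : ι) (Y : List ι) (s : ι),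
          X ++ (c :: Y ++ [s]) = (X ++ [c]) ++ (Y ++ [s]) := by simp
      rw [e₁] at h hp hn
      rw [e₁] at h hp
      -- The first label of each block stays in place: `permute_tail` needs one label more than the
      -- number of letters whose order matters.
      have h₁ := h.permute_tail hp (by simp; omega) hg (by simp; omega) (hperm hM')
      have hpV := (hperm hM').append_left (V₁ ++ [c₁])
      have hpU := (hperm hM).append_left (U₁ ++ [c₀])
      have h₂ := ((h₁.symm (hp.trans hpV)).permute_tail (hp.trans hpV).symm
        (by rw [← hpV.length_eq, ← hp.length_eq]; simp; omega) hf (by simp) (hperm hM))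
      have h₃ := h₂.symm ((hp.trans hpV).symm.trans hpU)
      rw [← List.append_assoc, ← List.append_assoc] at h₃
      have hpp := (hpU.symm.trans hp).trans hpV
      rw [← List.append_assoc, ← List.append_assoc] at hpp
      have hnU := hpU.nodup hn
      have hlU := hpU.length_eq
      rw [← List.append_assoc] at hnU
      refine (IH r (by omega)).agree_of_last_eq h₃ hnU
        ((List.perm_append_right_iff _).1 hpp) ?_ hr1
      simp at hlU ⊢; omega

end Main

/-! ### Agreement for pairwise swapped words -/

section PairSwapLevel

variable {A : Type u} {ι : Type w} [DecidableEq A] [DecidableEq ι]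

/-- Swap the first two and the last two of four letters. -/
def swapTwoPairs : List A → List A
  | [a, b, c, d] => [b, a, d, c]
  | l => l

theorem swapTwoPairs_perm (l : List A) : (swapTwoPairs l).Perm l := by
  unfold swapTwoPairs
  split
  · exact (List.Perm.swap _ _ _).trans (((List.Perm.swap _ _ _).cons _).cons _)
  · exact List.Perm.refl _

/-- Freezing two swapped pairs at once preserves `m` modulo 4, and the induction hypothesis gives
agreement up to a double transposition. With three pairs available, the rotations on the last five
letters absorb it. The induction ends with a single pair. -/
theorem PairSwap.agree (m : ℕ) : ∀ (C : Type (max u v)) (r : ℕ) (f g : List A → C)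
    (U V : List ι), U.length = m → m = r + 1 → m % 4 = 2 ∨ m % 4 = 3 → U.Nodup →
      PairSwap U V → LevelRel r f g U V → Agree r f g := by
  induction m using Nat.strong_induction_on with
  | _ m IH =>
  intro C r f g U V hm hmr hmod hn hUV h
  rcases hUV.eq_or_snoc with ⟨-, hl⟩ | ⟨U₁, V₁, x, y, rfl, rfl, hUV₁⟩
  · omega
  simp only [List.length_append, List.length_cons, List.length_nil] at hm
  rcases hUV₁.eq_or_snoc with ⟨rfl, hl⟩ | ⟨U₂, V₂, p, q, rfl, rfl, hUV₂⟩
  · intro l hl' hlr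
    rcases List.eq_nil_or_concat l with rfl | ⟨v, b, rfl⟩
    · simp at hlr; omega
    rw [List.concat_eq_append] at *
    simp only [List.length_append, List.length_cons, List.length_nil] at hlr
    obtain ⟨u, hu, h₁⟩ := h.eq_of_swap_end hn (List.Perm.refl _) (by omega) b (v := v) (by omega)
    have hvl : v.length ≤ 1 := by omega
    have huv : u = v := by
      match v, hvl with
      | [], _ => exact hu.eq_nil
      | [d], _ => exact List.perm_singleton.1 hu
    rw [huv] at h₁
    exact h₁ b hl'
  simp only [List.length_append, List.length_cons, List.length_nil] at hm
  rcases hUV₂.eq_or_snoc with ⟨rfl, hl⟩ | ⟨U₃, V₃, s, t, rfl, rfl, hUV₃⟩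
  · omega
  have hp₃ := hUV₃.perm
  have hlen₃ := hp₃.length_eq
  simp only [List.length_append, List.length_cons, List.length_nil] at hm
  obtain ⟨k, rfl⟩ : ∃ k, r = k + 4 := ⟨r - 4, by omega⟩
  simp only [List.append_assoc, List.cons_append, List.nil_append] at h hn
  -- the last four labels frozen
  have h₄ : LevelRel (k + 4) f g ((U₃ ++ [s, t]) ++ [p, q, x, y])
      ((V₃ ++ [t, s]) ++ [q, p, y, x]) := by simpa using h
  have hn₄ : ((U₃ ++ [s, t]) ++ [p, q, x, y]).Nodup := by simpa using hn
  have hf₄ := h₄.freeze (π := swapTwoPairs) hn₄ hUV₂.perm rfl (fun _ => rfl)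
    (fun l _ => swapTwoPairs_perm l)
  have hA := IH (m - 4) (by omega) _ k _ _ _ _ (by simp; omega) (by omega) (by omega)
    (List.nodup_append.1 hn₄).1 hUV₂ hf₄
  -- the last two labels frozen
  have h₂ : LevelRel (k + 2 + 2) f g ((U₃ ++ [s, t, p, q]) ++ [x, y])
      ((V₃ ++ [t, s, q, p]) ++ [y, x]) := by simpa using h
  have hn₂ : ((U₃ ++ [s, t, p, q]) ++ [x, y]).Nodup := by simpa using hn
  have hf₂ := h₂.freeze (π := List.reverse) hn₂
    (hp₃.append ((List.Perm.swap t s _).trans (((List.Perm.swap q p []).cons s).cons t))) rfl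
    (fun _ => by simp) (fun l _ => List.reverse_perm l)
  intro l hl hlr
  obtain ⟨l, c, d, rfl⟩ := exists_eq_append_pair (show 2 ≤ l.length by omega)
  simp only [List.length_append, List.length_cons, List.length_nil] at hlr
  obtain ⟨l, a, b, rfl⟩ := exists_eq_append_pair (show 2 ≤ l.length by omega)
  simp only [List.length_append, List.length_cons, List.length_nil] at hlr
  rcases List.eq_nil_or_concat l with rfl | ⟨v, e, rfl⟩
  · simp at hlr; omega
  simp only [List.concat_eq_append, List.length_append, List.length_cons, List.length_nil,
    List.append_assoc, List.cons_append, List.nil_append] at hl hlr ⊢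
  let G : A → A → A → A → A → Option C := fun a b c d e => guarded g (v ++ [a, b, c, d, e])
  have hrot : ∀ (a b c : A) (l : List A), (a :: b :: c :: l).Perm (c :: a :: b :: l) :=
    fun a b c l => ((List.Perm.swap c b l).cons a).trans (List.Perm.swap c a _)
  have hG₁ : ∀ a b c d e, G a b c d e = G c a b d e := by
    intro a b c d e
    refine guarded_congr ((hrot _ _ _ _).append_left v) fun hnd => ?_
    have hnd' : (v ++ [a, b, c] ++ [e, d]).Nodup := by
      refine List.Perm.nodup ?_ hnd
      simpa using ((((List.Perm.swap e d []).cons c).cons b).cons a).append_left v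
    have h₃ := hf₂.rotate_last (v := v) (b := a) (c := b) (d := c)
      (by simpa using (List.nodup_append.1 hn₂).1) hp₃ (by omega) (by omega)
      (List.nodup_append.1 hnd').1
    have := eq_of_freeze_eq h₃ hnd' ((hrot _ _ _ _).append_left v) rfl
    simpa using this
  have hG₂ : ∀ a b c d e, G a b c d e = G a b e c d := by
    intro a b c d e
    refine guarded_congr ((((hrot _ _ _ _).cons b).cons a).append_left v) fun hnd => ?_
    have := h₄.rotate_last (v := v ++ [a, b]) (b := c) (c := d) (d := e) (by simpa using hn)
      hUV₂.perm (by simp; omega) (by simp; omega) (by simpa using hnd)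
    simpa using this
  have hfg := hA.of_freeze (l := v ++ [e]) (s := [a, b, c, d]) (by simpa using hl)
    (by simp; omega) rfl
  simp only [swapTwoPairs, List.append_assoc, List.cons_append, List.nil_append] at hfg
  rw [hfg]
  refine (eq_of_guarded hl ?_ (double_swap_of_rotations hG₁ hG₂ e a b c d)).symm
  exact (((List.Perm.swap b a _).trans (((List.Perm.swap d c []).cons a).cons b)).cons
    e).append_left v

theorem PairSwap.shape {U V : List ι} (h : PairSwap U V) :
    (2 ≤ U.length → U.length % 2 = 0 → ∃ a b U' V', U = a :: b :: U' ∧ V = b :: a :: V') ∧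
    (2 ≤ U.length → U.length % 2 = 1 →
      ∃ t a b U' V', U = t :: a :: b :: U' ∧ V = t :: b :: a :: V') := by
  induction h with
  | nil => simp
  | single x => simp
  | @snoc U V x y h ih =>
    simp only [List.length_append, List.length_cons, List.length_nil]
    rcases h.eq_or_snoc with ⟨rfl, hl⟩ | ⟨U₁, V₁, p, q, hU, -, -⟩
    · match U, hl with
      | [], _ => exact ⟨fun _ _ => ⟨x, y, [], [], rfl, rfl⟩, by simp⟩
      | [t], _ => exact ⟨by simp, fun _ _ => ⟨t, x, y, [], [], rfl, rfl⟩⟩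
    · have hl : 2 ≤ U.length := by rw [hU]; simp
      constructor
      · intro _ hm
        obtain ⟨a, b, U', V', rfl, rfl⟩ := ih.1 hl (by omega)
        exact ⟨a, b, _, _, rfl, rfl⟩
      · intro _ hm
        obtain ⟨t, a, b, U', V', rfl, rfl⟩ := ih.2 hl (by omega)
        exact ⟨t, a, b, _, _, rfl, rfl⟩

end PairSwapLevel

/-! ### Lower levels, by identifying labels -/

section Merge

variable {A : Type u} {ι : Type w} [DecidableEq A] [DecidableEq ι]

/-- Replace the label `j` by `i`. -/
def merge (i j x : ι) : ι := if x = j then i else x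

theorem firstOcc_merge_perm {U : List ι} {i j : ι} (hn : U.Nodup) (hi : i ∈ U) (hij : i ≠ j) :
    (firstOcc (U.map (merge i j))).Perm (U.erase j) := by
  rw [List.perm_ext_iff_of_nodup (firstOcc_nodup _) (hn.erase j)]
  intro x
  rw [mem_firstOcc, List.mem_map, hn.mem_erase_iff]
  constructor
  · rintro ⟨z, hz, rfl⟩
    unfold merge
    split_ifs with h
    · exact ⟨hij, hi⟩
    · exact ⟨h, hz⟩
  · rintro ⟨hx, hxU⟩
    exact ⟨x, hxU, by simp [merge, hx]⟩

theorem firstOcc_map_cons_head {κ : Type*} (φ : κ → ι) (x : κ) (U : List κ) :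
    ∃ U', firstOcc ((x :: U).map φ) = φ x :: U' := ⟨_, rfl⟩

theorem firstOcc_map_cons_cons {κ : Type*} (φ : κ → ι) (x y : κ) (U : List κ) (h : φ y ≠ φ x) :
    ∃ U', firstOcc ((x :: y :: U).map φ) = φ x :: φ y :: U' := by
  refine ⟨((firstOcc (U.map φ)).filter fun z => z ≠ φ y).filter fun z => z ≠ φ x, ?_⟩
  simp only [List.map_cons, firstOcc]
  rw [List.filter_cons_of_pos (by simpa using h)]

variable {C : Type (max u v)} {r : ℕ} {f g : List A → C} {U V : List ι}

theorem LevelRel.agree_of_mod (h : LevelRel r f g U V) (hn : U.Nodup) (hp : U.Perm V)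
    (hlen : U.length = r + 1) (hmod : (r + 1) % 4 = 2 ∨ (r + 1) % 4 = 3) : Agree r f g := by
  by_cases hUV : PairSwap U V
  · exact PairSwap.agree _ C r f g U V hlen rfl hmod hn hUV h
  · exact (solvable _ C r f g U V hlen rfl hn hp h hUV).1

theorem LevelRel.merge (h : LevelRel r f g U V) (hn : U.Nodup) (hp : U.Perm V) {i j : ι}
    (hi : i ∈ U) (hj : j ∈ U) (hij : i ≠ j) :
    LevelRel r f g (firstOcc (U.map (merge i j))) (firstOcc (V.map (merge i j))) ∧
      (firstOcc (U.map (MinorReconstruction.merge i j))).Nodup ∧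
      (firstOcc (U.map (MinorReconstruction.merge i j))).Perm
        (firstOcc (V.map (MinorReconstruction.merge i j))) ∧
      (firstOcc (U.map (MinorReconstruction.merge i j))).length + 1 = U.length := by
  refine ⟨h.minor _, firstOcc_nodup _, firstOcc_perm (hp.map _), ?_⟩
  rw [(firstOcc_merge_perm hn hi hij).length_eq, List.length_erase_of_mem hj]
  have := List.length_pos_of_mem hj
  omega

/-- Some pair of labels can be identified so that the result is not pairwise swapped. -/
theorem exists_merge_not_pairSwap (hn : U.Nodup) (hp : U.Perm V) (hlen : 3 ≤ U.length) :
    ∃ i ∈ U, ∃ j ∈ U, i ≠ j ∧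
      ¬ PairSwap (firstOcc (U.map (merge i j))) (firstOcc (V.map (merge i j))) := by
  have hnV := hp.nodup_iff.1 hn
  have hlV := hp.length_eq
  have hlm : ∀ {i j}, i ∈ U → j ∈ U → i ≠ j →
      (firstOcc (U.map (merge i j))).length = U.length - 1 := by
    intro i j hi hj hij
    rw [(firstOcc_merge_perm hn hi hij).length_eq, List.length_erase_of_mem hj]
  obtain ⟨x, U₁, rfl⟩ := List.exists_cons_of_length_pos (show 0 < U.length by omega)
  obtain ⟨c, V₁, rfl⟩ := List.exists_cons_of_length_pos (show 0 < V.length by omega)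
  have hcU : c ∈ x :: U₁ := hp.mem_iff.2 (by simp)
  -- words of even length with equal heads are not pairwise swapped
  have hhead : ∀ {i j}, i ∈ x :: U₁ → j ∈ x :: U₁ → i ≠ j → merge i j x = merge i j c →
      (x :: U₁).length % 2 = 1 →
      ¬ PairSwap (firstOcc ((x :: U₁).map (merge i j))) (firstOcc ((c :: V₁).map (merge i j))) := by
    intro i j hi hj hij hxc hodd hPS
    obtain ⟨a, b, U', V', hU', hV'⟩ := hPS.shape.1 (by rw [hlm hi hj hij]; omega)
      (by rw [hlm hi hj hij]; omega)
    obtain ⟨U'', hU''⟩ := firstOcc_map_cons_head (merge i j) x U₁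
    obtain ⟨V'', hV''⟩ := firstOcc_map_cons_head (merge i j) c V₁
    have hnd := firstOcc_nodup ((x :: U₁).map (merge i j))
    rw [hU'] at hnd
    rw [hU', List.cons.injEq] at hU''
    rw [hV', List.cons.injEq] at hV''
    have : a = b := by rw [hU''.1, hV''.1, hxc]
    simp [this] at hnd
  -- Pairwise swapped words of even length differ in the first place; those of odd length at least 3
  -- agree there and differ in the second. An identification shortens the words by one, so the
  -- parity of the original length decides which of these features to destroy.
  rcases Nat.mod_two_eq_zero_or_one (x :: U₁).length with hpar | hpar
  · by_cases hxc : x = c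
    · subst hxc
      simp only [List.length_cons] at hlen hpar hlV
      obtain ⟨y, U₂, rfl⟩ := List.exists_cons_of_length_pos (show 0 < U₁.length by omega)
      obtain ⟨d, V₂, rfl⟩ := List.exists_cons_of_length_pos (show 0 < V₁.length by omega)
      have hyx : y ≠ x := by rintro rfl; simp at hn
      have hdx : d ≠ x := by rintro rfl; simp at hnV
      have hdU : d ∈ x :: y :: U₂ := hp.mem_iff.2 (by simp)
      simp only [List.length_cons] at hlen hpar hlV
      have hsecond : ∀ {i j}, i ∈ x :: y :: U₂ → j ∈ x :: y :: U₂ → i ≠ j →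
          merge i j y = merge i j d → merge i j y ≠ merge i j x →
          ¬ PairSwap (firstOcc ((x :: y :: U₂).map (merge i j)))
            (firstOcc ((x :: d :: V₂).map (merge i j))) := by
        intro i j hi hj hij hyd hyx' hPS
        obtain ⟨t, a, b, U', V', hU', hV'⟩ := hPS.shape.2
          (by rw [hlm hi hj hij]; simp; omega) (by rw [hlm hi hj hij]; simp; omega)
        obtain ⟨U'', hU''⟩ := firstOcc_map_cons_cons (merge i j) x y U₂ hyx'
        obtain ⟨V'', hV''⟩ := firstOcc_map_cons_cons (merge i j) x d V₂ (hyd ▸ hyx')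
        have hnd := firstOcc_nodup ((x :: y :: U₂).map (merge i j))
        rw [hU'] at hnd
        rw [hU', List.cons.injEq, List.cons.injEq] at hU''
        rw [hV', List.cons.injEq, List.cons.injEq] at hV''
        have : a = b := by rw [hU''.2.1, hV''.2.1, hyd]
        simp [this] at hnd
      by_cases hyd : y = d
      · subst hyd
        obtain ⟨z, U₃, rfl⟩ := List.exists_cons_of_length_pos (show 0 < U₂.length by omega)
        have hzx : z ≠ x := by rintro rfl; simp at hn
        have hzy : z ≠ y := by rintro rfl; simp at hn
        refine ⟨x, by simp, z, by simp, hzx.symm, hsecond (by simp) (by simp) hzx.symm rfl ?_⟩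
        simp [merge, hzx.symm, hzy.symm, hyx]
      · refine ⟨y, by simp, d, hdU, hyd, hsecond (by simp) hdU hyd ?_ ?_⟩
        · simp [merge]
        · simp [merge, hyd, hdx.symm, hyx]
    · -- two labels other than the two heads
      have hcU₁ : c ∈ U₁ := by simpa [Ne.symm hxc] using hcU
      have hlE : (U₁.erase c).length + 2 = (x :: U₁).length := by
        rw [List.length_erase_of_mem hcU₁]
        have := List.length_pos_of_mem hcU₁
        simp; omega
      have hnE : (x :: c :: U₁.erase c).Nodup :=
        ((List.perm_cons_erase hcU₁).cons x).nodup hn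
      match hE : U₁.erase c, hlE, hnE with
      | [], hlE, _ => simp only [List.length_nil] at hlE; omega
      | [_], hlE, _ => simp only [List.length_cons, List.length_nil] at hlE hpar; omega
      | i :: j :: E, _, hnE =>
        have hi : i ∈ x :: U₁ := List.mem_cons_of_mem _ (List.mem_of_mem_erase (a := i) (b := c)
          (by rw [hE]; simp))
        have hj : j ∈ x :: U₁ := List.mem_cons_of_mem _ (List.mem_of_mem_erase (a := j) (b := c)
          (by rw [hE]; simp))
        simp only [List.nodup_cons, List.mem_cons, not_or] at hnE
        have hij : i ≠ j := hnE.2.2.1.1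
        refine ⟨i, hi, j, hj, hij, fun hPS => ?_⟩
        obtain ⟨t, a, b, U', V', hU', hV'⟩ := hPS.shape.2
          (by rw [hlm hi hj hij]; omega) (by rw [hlm hi hj hij]; omega)
        obtain ⟨U'', hU''⟩ := firstOcc_map_cons_head (merge i j) x U₁
        obtain ⟨V'', hV''⟩ := firstOcc_map_cons_head (merge i j) c V₁
        rw [hU', List.cons.injEq] at hU''
        rw [hV', List.cons.injEq] at hV''
        have hmx : merge i j x = x := if_neg hnE.1.2.2.1
        have hmc : merge i j c = c := if_neg hnE.2.1.2.1
        rw [hmx] at hU''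
        rw [hmc] at hV''
        exact hxc (hU''.1.symm.trans hV''.1)
  · by_cases hxc : x = c
    · subst hxc
      simp only [List.length_cons] at hlen
      obtain ⟨y, U₂, rfl⟩ := List.exists_cons_of_length_pos (show 0 < U₁.length by omega)
      have hyx : x ≠ y := by rintro rfl; simp at hn
      exact ⟨x, by simp, y, by simp, hyx, hhead (by simp) (by simp) hyx rfl hpar⟩
    · refine ⟨x, by simp, c, hcU, hxc, hhead (by simp) hcU hxc ?_ hpar⟩
      simp [merge]

/-- Labels are identified until `r + 1` remain; only the last identification has to avoid pairwise
swapped words. -/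
theorem LevelRel.agree_of_lt (h : LevelRel r f g U V) (hn : U.Nodup) (hp : U.Perm V)
    (hr : 1 ≤ r) (hlen : r + 2 ≤ U.length) : Agree r f g := by
  induction hm : U.length using Nat.strong_induction_on generalizing U V with
  | _ m IH =>
  subst hm
  obtain ⟨i, hi, j, hj, hij, hns⟩ := exists_merge_not_pairSwap hn hp (by omega)
  obtain ⟨h', hn', hp', hl'⟩ := h.merge hn hp hi hj hij
  by_cases hlr : U.length = r + 2
  · exact (solvable _ C r f g _ _ rfl (by omega) hn' hp' h' hns).1
  · exact IH _ (by omega) h' hn' hp' (by omega) rfl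

end Merge

/-! ### Cards with an inessential argument -/

section Inessential

variable {A : Type u} {C : Type v} [DecidableEq A]

theorem firstOcc_append_replicate_end {l : List A} {x : A} (h : x ∈ l) (n : ℕ) :
    firstOcc (l ++ List.replicate n x) = firstOcc l :=
  firstOcc_append_of_subset fun _ hy => List.eq_of_mem_replicate hy ▸ h

theorem firstOcc_append_replicate {l₁ l₂ : List A} {x : A} (h : x ∈ l₁) (n : ℕ) :
    firstOcc (l₁ ++ (List.replicate n x ++ l₂)) = firstOcc (l₁ ++ l₂) := by
  induction n with
  | zero => simp
  | succ n ih =>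
    rw [List.replicate_succ, List.cons_append, firstOcc_append_cons_of_mem h, ih]

/-- If the letter after the first `s` letters of a word never matters, then only the first letter
of the order of first occurrence matters. -/
theorem eq_head_of_inessential {f : List A → C} {s t : ℕ}
    (H : ∀ (l₁ l₂ : List A) (y z : A), l₁.length = s → l₂.length = t →
      f (firstOcc (l₁ ++ y :: l₂)) = f (firstOcc (l₁ ++ z :: l₂)))
    {x : A} {l : List A} (hn : (x :: l).Nodup) (hl : (x :: l).length ≤ s + t) :
    f (x :: l) = f [x] := by
  rcases Nat.eq_zero_or_pos s with rfl | hs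
  · have H' : ∀ (l₂ : List A) (y z : A), l₂.length = t →
        f (firstOcc (y :: l₂)) = f (firstOcc (z :: l₂)) := fun l₂ y z h => H [] l₂ y z rfl h
    have hdrop : ∀ (y z : A) (l : List A), (y :: z :: l).Nodup → l.length + 1 ≤ t →
        f (y :: z :: l) = f (z :: l) := by
      intro y z l hn hl
      have := H' ((z :: l) ++ List.replicate (t - (l.length + 1)) z) y z (by simp; omega)
      have e₁ := firstOcc_append_replicate_end (l := y :: z :: l) (x := z) (by simp)
        (t - (l.length + 1))
      have e₂ := firstOcc_append_replicate_end (l := [z] ++ z :: l) (x := z) (by simp)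
        (t - (l.length + 1))
      rw [firstOcc_of_nodup hn] at e₁
      rw [firstOcc_of_dup (l₁ := [z]) (l₂ := l) (by simp) (List.nodup_cons.1 hn).2] at e₂
      simp only [List.cons_append, List.nil_append] at this e₁ e₂
      rw [e₁, e₂] at this
      exact this
    have hlast : ∀ v : List A, (v ++ [x]).Nodup → v.length ≤ t → f (v ++ [x]) = f [x] := by
      intro v
      induction v with
      | nil => simp
      | cons y v ih =>
        intro hn hv
        rw [← ih (List.nodup_cons.1 hn).2 (by simp at hv; omega)]
        match v, hn, hv with
        | [], hn, hv => exact hdrop y x [] hn (by simpa using hv)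
        | z :: v, hn, hv =>
          exact hdrop y z (v ++ [x]) hn (by simp at hv ⊢; omega)
    cases l with
    | nil => rfl
    | cons z l =>
      simp only [List.length_cons, Nat.zero_add] at hl
      have hn' : ((z :: l) ++ [x]).Nodup := (List.perm_append_singleton x _).nodup_iff.2 hn
      rw [← hlast (z :: l) hn' (by simp; omega)]
      -- With a spare copy of `x` behind, replacing the leading `x` by `z` turns `x :: z :: l` into
      -- `z :: l ++ [x]`, to which `hlast` applies.
      have := H' ((z :: l) ++ x :: List.replicate (t - (l.length + 1 + 1)) x) x z
        (by simp; omega)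
      have e₁ := firstOcc_append_replicate_end (l := x :: z :: l) (x := x) (by simp)
        (t - (l.length + 1 + 1) + 1)
      have e₂ := firstOcc_append_replicate_end (l := [z] ++ z :: (l ++ [x])) (x := x)
        (by simp) (t - (l.length + 1 + 1))
      rw [firstOcc_of_nodup hn] at e₁
      rw [firstOcc_of_dup (l₁ := [z]) (l₂ := l ++ [x]) (by simp) hn'] at e₂
      simp only [List.cons_append, List.nil_append, List.replicate_succ, List.append_assoc]
        at this e₁ e₂
      rw [e₁, e₂] at this
      exact this
  · induction hlen : l.length using Nat.strong_induction_on generalizing l with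
    | _ n IH =>
    subst hlen
    rcases Nat.eq_zero_or_pos l.length with h0 | hpos
    · rw [List.length_eq_zero_iff.1 h0]
    simp only [List.length_cons] at hl
    -- The letter `l[i]` is to be erased by replacing it with `x`. In `x :: l` it has `i + 1 ≤ s`
    -- letters before it and at most `t` after it, so padding with copies of `x` puts it at the
    -- inessential place.
    obtain ⟨i, hi₁, hi₂, hi₃⟩ : ∃ i, i + 1 ≤ s ∧ i < l.length ∧ l.length ≤ i + 1 + t :=
      ⟨min s l.length - 1, by omega, by omega, by omega⟩
    have hsplit : l = l.take i ++ l[i] :: l.drop (i + 1) := by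
      rw [← List.drop_eq_getElem_cons hi₂, List.take_append_drop]
    have h₁ : (l.take i).length = i := by simp; omega
    have h₂ : (l.drop (i + 1)).length + (i + 1) = l.length := by simp; omega
    generalize l[i] = b at hsplit
    generalize l.take i = l₁ at *
    generalize l.drop (i + 1) = l₂ at *
    subst hsplit
    simp only [List.length_append, List.length_cons] at hl hi₃ h₂ IH
    have hn' : (x :: (l₁ ++ l₂)).Nodup := hn.sublist (by simp)
    rw [← IH (l₁ ++ l₂).length (by simp) hn' (by simp; omega) rfl]
    have := H ((x :: l₁) ++ List.replicate (s - (i + 1)) x)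
      (l₂ ++ List.replicate (t - l₂.length) x) b x (by simp; omega) (by simp; omega)
    have key : ∀ y, firstOcc ((x :: l₁) ++ List.replicate (s - (i + 1)) x ++
        y :: (l₂ ++ List.replicate (t - l₂.length) x)) = firstOcc ((x :: l₁) ++ y :: l₂) := by
      intro y
      rw [List.append_assoc, firstOcc_append_replicate (by simp), ← List.cons_append,
        ← List.append_assoc,
        firstOcc_append_replicate_end (by simp)]
    rw [key, key, firstOcc_append_cons_of_mem (x := x) (by simp), List.cons_append, List.cons_append,
      firstOcc_of_nodup hn, firstOcc_of_nodup hn'] at this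
    exact this

theorem eq_head_of_inessential_label {ι : Type w} [DecidableEq ι] {f : List A → C} {U : List ι}
    (hn : U.Nodup) {p : ι} (hp : p ∈ U)
    (H : ∀ a b : ι → A, (∀ x, x ≠ p → a x = b x) →
      f (firstOcc (U.map a)) = f (firstOcc (U.map b)))
    {x : A} {l : List A} (hl : (x :: l).Nodup) (hlen : (x :: l).length < U.length) :
    f (x :: l) = f [x] := by
  obtain ⟨U₁, U₂, rfl⟩ := List.append_of_mem hp
  refine eq_head_of_inessential (s := U₁.length) (t := U₂.length) ?_ hl
    (by simp at hlen ⊢; omega)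
  intro l₁ l₂ y z h₁ h₂
  have key : ∀ y, ∃ a : ι → A, (U₁ ++ p :: U₂).map a = l₁ ++ y :: l₂ := fun y =>
    exists_map_eq (fun _ => y) hn (by simp [h₁, h₂])
  obtain ⟨a, ha⟩ := key y
  have hb : (U₁ ++ p :: U₂).map (Function.update a p z) = l₁ ++ z :: l₂ := by
    rw [List.map_append, List.map_cons] at ha
    obtain ⟨e₁, e₂⟩ := List.append_inj ha (by simp [h₁])
    rw [List.cons.injEq] at e₂
    have hup : ∀ W : List ι, p ∉ W → W.map (Function.update a p z) = W.map a := by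
      intro W hW
      apply List.map_congr_left
      intro q hq
      rw [Function.update_of_ne]
      rintro rfl
      exact hW hq
    have hnp := List.nodup_middle.1 hn
    rw [List.nodup_cons, List.mem_append, not_or] at hnp
    rw [List.map_append, List.map_cons, hup _ hnp.1.1, hup _ hnp.1.2, Function.update_self, e₁,
      e₂.2]
  rw [← ha, ← hb]
  exact H _ _ fun q hq => by rw [Function.update_of_ne hq]

end Inessential

/-! ### Reconstruction from a single card -/

section Reconstruction

variable {A : Type u} {B : Type v} [DecidableEq A]

/-- A function on repetition-free words, extended to all words. -/
def extend (F : Sharp A → B) (l : List A) : ULift.{u} (Option B) :=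
  if h : l ≠ [] ∧ l.Nodup then ⟨some (F ⟨l, h⟩)⟩ else ⟨none⟩

theorem extend_coe (F : Sharp A → B) (l : Sharp A) : extend F l.1 = ⟨some (F l)⟩ :=
  dif_pos l.2

theorem delta_surjective {n : ℕ} (I : Couple n) : Function.Surjective (delta I) := by
  intro x
  by_cases h : x.1 < I.1.2.1
  · refine ⟨⟨x.1, by omega⟩, ?_⟩
    simp [delta, Fin.lt_def, h]
  · refine ⟨⟨x.1 + 1, by omega⟩, ?_⟩
    have h₁ : ¬ x.1 + 1 < I.1.2.1 := by omega
    have h₂ : x.1 + 1 ≠ I.1.2.1 := by omega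
    simp [delta, Fin.lt_def, Fin.ext_iff, h₁, h₂]

theorem exists_word_idMinor {n : ℕ} (hn : 0 < n) {f : (Fin n → A) → B} {F : Sharp A → B}
    {σ : Equiv.Perm (Fin n)} (hf : ∀ a, f a = F (ofo hn (a ∘ σ))) (I : Couple n) :
    ∃ U : List (Fin (n - 1)), U.Nodup ∧ (∀ x, x ∈ U) ∧
      ∀ a, extend F (firstOcc (U.map a)) = ⟨some (idMinor f I a)⟩ := by
  refine ⟨firstOcc (List.ofFn (delta I ∘ σ)), firstOcc_nodup _, fun x => ?_, fun a => ?_⟩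
  · rw [mem_firstOcc, List.mem_ofFn]
    exact (delta_surjective I).comp σ.surjective x
  · rw [firstOcc_map_firstOcc, List.map_ofFn, idMinor, hf]
    exact extend_coe F (ofo hn ((a ∘ delta I) ∘ σ))

theorem length_of_full {m : ℕ} {U : List (Fin m)} (hn : U.Nodup) (hU : ∀ x, x ∈ U) :
    U.length = m := by
  have h : U.toFinset = Finset.univ := by
    ext x
    simp [hU x]
  rw [← List.toFinset_card_of_nodup hn, h, Finset.card_univ, Fintype.card_fin]

theorem eq_head_of_not_surjective {m : ℕ} {F : Sharp A → B} {f : (Fin m → A) → B}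
    {U : List (Fin m)} (hn : U.Nodup) (hU : ∀ x, x ∈ U)
    (hf : ∀ a, extend F (firstOcc (U.map a)) = ⟨some (f a)⟩) {p : Fin m}
    (hp : ∀ a b : Fin m → A, (∀ x, x ≠ p → a x = b x) → f a = f b)
    {x : A} {l : List A} (hl : (x :: l).Nodup) (hlen : (x :: l).length < m) :
    extend F (x :: l) = extend F [x] := by
  refine eq_head_of_inessential_label hn (hU p) ?_ hl (by rwa [length_of_full hn hU])
  intro a b hab
  rw [hf, hf, hp a b hab]

theorem eq_of_equivalent {k m : ℕ} [Fintype A] (hA : Fintype.card A = k)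
    (hm : k + 1 ≤ m) (hmod : k + 2 ≤ m ∨ k % 4 = 1 ∨ k % 4 = 2) {F G : Sharp A → B}
    {f g : (Fin m → A) → B} {U V : List (Fin m)} (hnU : U.Nodup) (hU : ∀ x, x ∈ U)
    (hf : ∀ a, extend F (firstOcc (U.map a)) = ⟨some (f a)⟩) (hnV : V.Nodup) (hV : ∀ x, x ∈ V)
    (hg : ∀ a, extend G (firstOcc (V.map a)) = ⟨some (g a)⟩) (hfg : Equivalent f g) :
    F = G := by
  obtain ⟨⟨σ, hσ⟩, ⟨τ, hτ⟩⟩ := hfg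
  have hUl := length_of_full hnU hU
  suffices h : ∀ l : List A, l ≠ [] → l.Nodup → extend F l = extend G l by
    funext l
    have := h l.1 l.2.1 l.2.2
    rw [extend_coe, extend_coe] at this
    simpa using this
  intro l hl hln
  have hlk : l.length ≤ k := hA ▸ hln.length_le_card
  have hl1 : 1 ≤ l.length := List.length_pos_iff.2 hl
  have hrel : ∀ a, extend F (firstOcc (U.map a)) = extend G (firstOcc ((V.map σ).map a)) := by
    intro a
    rw [hf, hσ, List.map_map, hg]
  by_cases hinj : Function.Injective σ
  · have hnV' : (V.map σ).Nodup := hnV.map hinj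
    have hp : U.Perm (V.map σ) := by
      rw [List.perm_ext_iff_of_nodup hnU hnV']
      intro x
      obtain ⟨y, rfl⟩ := (Finite.injective_iff_surjective.1 hinj) x
      simp [hU, hV]
    have hL : LevelRel l.length (extend F) (extend G) U (V.map σ) := fun a _ => hrel a
    -- In the remaining case `l.length = k` and `m = k + 1`, so `k ≡ 1, 2 (mod 4)` and the number of
    -- labels is `2` or `3` modulo 4.
    by_cases hlt : l.length + 2 ≤ m
    · exact hL.agree_of_lt.{u, v, 0} hnU hp hl1 (by omega) l hln rfl
    · exact hL.agree_of_mod.{u, v, 0} hnU hp (by omega) (by omega) l hln rfl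
  · have hns : ¬ Function.Surjective σ := fun h => hinj (Finite.injective_iff_surjective.2 h)
    rw [Function.Surjective] at hns
    push Not at hns
    obtain ⟨p, hp⟩ := hns
    have hpf : ∀ a b : Fin m → A, (∀ x, x ≠ p → a x = b x) → f a = f b := by
      intro a b hab
      rw [hσ, hσ]
      congr 1
      funext x
      exact hab _ (hp x)
    -- An inessential argument of `f` passes to `g`: through `τ` if it is injective, and otherwise
    -- from a label that `τ` misses.
    have hqg : ∃ q, ∀ a b : Fin m → A, (∀ x, x ≠ q → a x = b x) → g a = g b := by
      by_cases hτi : Function.Injective τ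
      · refine ⟨τ p, fun a b hab => ?_⟩
        rw [hτ, hτ]
        exact hpf _ _ fun x hx => hab _ fun h => hx (hτi h)
      · have hns : ¬ Function.Surjective τ := fun h => hτi (Finite.injective_iff_surjective.2 h)
        rw [Function.Surjective] at hns
        push Not at hns
        obtain ⟨q, hq⟩ := hns
        refine ⟨q, fun a b hab => ?_⟩
        rw [hτ, hτ]
        congr 1
        funext x
        exact hab _ (hq x)
    obtain ⟨q, hq⟩ := hqg
    match l, hl, hln, hlk with
    | x :: l, _, hln, hlk =>
      rw [eq_head_of_not_surjective hnU hU hf hpf hln (by omega),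
        eq_head_of_not_surjective hnV hV hg hq hln (by omega)]
      have key : ∀ {W : List (Fin m)}, W ≠ [] → firstOcc (W.map fun _ => x) = [x] := by
        intro W hW
        refine List.perm_singleton.1 ?_
        rw [List.perm_ext_iff_of_nodup (firstOcc_nodup _) (by simp)]
        intro y
        simp [mem_firstOcc, hW, eq_comm]
      -- Both values now depend only on the first letter, and a constant substitution compares them.
      have h₁ := hrel fun _ => x
      rwa [key (List.ne_nil_of_mem (hU p)),
        key (by simpa using List.ne_nil_of_mem (hV p))] at h₁

theorem equivalent_of_deck_eq [Fintype A] {k n : ℕ} (hA : Fintype.card A = k)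
    (hn : 0 < n) (hkn : LargeArity k n) {f g : (Fin n → A) → B}
    (hf : WeaklyDeterminedByOfo hn f) (hg : WeaklyDeterminedByOfo hn g) (hd : deck f = deck g) :
    Equivalent f g := by
  obtain ⟨F, σ, hF⟩ := hf
  obtain ⟨G, τ, hG⟩ := hg
  simp only [LargeArity, Nat.ModEq] at hkn
  -- Any couple would do, since one common card determines the map on repetition-free words.
  let I : Couple n := ⟨(⟨0, by omega⟩, ⟨1, by omega⟩), by simp [Fin.lt_def]⟩
  have hI : Quotient.mk (MultiFun.setoid A B) ⟨n - 1, I.pred_pos, idMinor f I⟩ ∈ deck g := by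
    rw [← hd]
    exact Multiset.mem_map_of_mem _ (Finset.mem_univ I)
  obtain ⟨J, -, hJ⟩ := Multiset.mem_map.1 hI
  have hIJ : Equivalent (idMinor f I) (idMinor g J) := Quotient.exact hJ.symm
  obtain ⟨U, hnU, hU, hfU⟩ := exists_word_idMinor hn hF I
  obtain ⟨V, hnV, hV, hgV⟩ := exists_word_idMinor hn hG J
  obtain rfl := eq_of_equivalent hA (by omega) (by omega) hnU hU hfU hnV hV hgV hIJ
  refine ⟨⟨σ ∘ τ.symm, fun a => ?_⟩, ⟨τ ∘ σ.symm, fun a => ?_⟩⟩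
  · rw [hF, hG]
    congr 2
    funext x
    simp
  · rw [hF, hG]
    congr 2
    funext x
    simp

end Reconstruction

end MinorReconstruction

theorem mainTheorem3 {A : Type*} {B : Type*} [Fintype A] [DecidableEq A] (k : ℕ) (hk : 0 < k)
    (hA : Fintype.card A = k) :
    (∀ (n : ℕ) (hn : 0 < n), LargeArity k n →
      ∀ f g : (Fin n → A) → B, WeaklyDeterminedByOfo hn f → WeaklyDeterminedByOfo hn g →
        deck f = deck g → Equivalent f g) ∧
    WeaklyReconstructible
      {F : MultiFun A B | LargeArity k F.arity ∧ WeaklyDeterminedByOfo F.arity_pos F.toFun} := by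
  refine ⟨fun n hn hkn f g hf hg hd => equivalent_of_deck_eq hA hn hkn hf hg hd, ?_⟩
  intro n hn f g hf hg hd
  exact equivalent_of_deck_eq (n := n) hA (by omega) hf.1 hf.2 hg.2 hd
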